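/- Let $d\ge 1$ and write $\|\cdot\|$ for the Euclidean norm on $\mathbb R^d$. Let $(\Xi,\mathcal F,\mathbb P)$ be a probability space and $F:\mathbb R^d\times\Xi\to\mathbb R$ be such that $y\mapsto F(y;\xi)$ is differentiable for every $\xi$, $\xi\mapsto F(y;\xi)$ is measurable and $\mathbb P$-integrable for every $y$, and $f(y):=\mathbb E_{\xi\sim\mathbb P}[F(y;\xi)]$ is bounded below, with $f_*:=\inf_{y} f(y)>-\infty$. Assume: (i) (sample smoothness) there is $L\ge 0$ such that, for $\mathbb P$-almost every $\xi$, $\|\nabla F(y;\xi)-\nabla F(z;\xi)\|\le L\|y-z\|$ for all $y,z\in\mathbb R^d$; (ii) (weak-$L_p$ gradient noise) there are $p\in(1,2]$ and $\sigma>0$ such that, for all $y\in\mathbb R^d$ and $t>0$, $\mathbb P\big(\|\nabla F(y;\xi)-\nabla f(y)\|>t\big)\le(\sigma/t)^p$. Let $\mu>0$, $x_0\in\mathbb R^d$, and put $$\bar\Delta_0:=f(x_0)-f_*+\frac{L\mu^2}{2},\qquad S_\mu:=\frac{\sqrt{L\bar\Delta_0}+\sigma}{\sqrt d}+L\mu .$$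 Let $f_\mu(y):=\mathbb E_v[f(y+\mu v)]$, where $v$ is uniform on the closed unit ball of $\mathbb R^d$. Fix $\delta\in(0,1]$ and $T\ge 3$, set $\lambda:=\log(T/\delta)$, let $M\in\mathbb N$ satisfy $M\ge\lambda$, and let $x\in\mathbb R^d$ be a fixed point with $f(x)-f_*\le 4\bar\Delta_0$. Put $\tau:=8S_\mu(M/\lambda)^{1/p}$ and $\psi_\tau(z):=z\min\{1,\tau/|z|\}$ (with $\psi_\tau(0)=0$). Let $(u_\ell,\xi_\ell)$, $\ell=1,\dots,M$, be i.i.d. pairs, where $u_\ell$ is uniform on the unit sphere $\mathbb S^{d-1}$, $\xi_\ell\sim\mathbb P$, and $u_\ell$ is independent of $\xi_\ell$, and define $$Y_\ell:=\frac{F(x+\mu u_\ell;\xi_\ell)-F(x-\mu u_\ell;\xi_\ell)}{2\mu},\qquad g(x):=\frac dM\sum_{\ell=1}^M\psi_\tau(Y_\ell)\,u_\ell .$$ Then $f_\mu$ is differentiable at $x$ and, with probability at least $1-\delta/T$, $$\|g(x)-\nabla f_\mu(x)\|\le C_p\,d\,S_\mu\Big(\frac{\lambda}{M}\Big)^{\frac{p-1}{p}}\sqrt{1+\log(M/\lambda)},\qquad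 C_p:=120+\frac{2^{4-p}}{p-1}.$$ -/

import Mathlib

open MeasureTheory ProbabilityTheory

noncomputable section

namespace ZerothOrder

/-- The uniform probability distribution on the unit sphere of `ℝ^d` (for `d ≥ 1`): normalized surface
measure. For `d = 1` it is the uniform distribution on the two points of the sphere. -/
def unifSphere (d : ℕ) : Measure (Metric.sphere (0 : EuclideanSpace ℝ (Fin d)) 1) :=
  ((volume : Measure (EuclideanSpace ℝ (Fin d))).toSphere Set.univ)⁻¹ •
    (volume : Measure (EuclideanSpace ℝ (Fin d))).toSphere

/-- The objective `f(x) = E_ξ [F(x; ξ)]`. -/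
def objective {d : ℕ} {Ξ : Type*} [MeasurableSpace Ξ] (P : Measure Ξ)
    (F : EuclideanSpace ℝ (Fin d) → Ξ → ℝ) (x : EuclideanSpace ℝ (Fin d)) : ℝ :=
  ∫ ξ, F x ξ ∂P

/-- Spherical smoothing `f_μ(x) = E_v [f(x + μ v)]`, with `v` uniform on the closed unit ball. -/
def smoothing {d : ℕ} (μ : ℝ) (f : EuclideanSpace ℝ (Fin d) → ℝ)
    (x : EuclideanSpace ℝ (Fin d)) : ℝ :=
  ⨍ v in Metric.closedBall (0 : EuclideanSpace ℝ (Fin d)) 1, f (x + μ • v)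

/-- `Δ̄₀ = (f(x₀) - inf f) + L μ² / 2`. -/
def barGap {d : ℕ} (L μ : ℝ) (f : EuclideanSpace ℝ (Fin d) → ℝ)
    (x₀ : EuclideanSpace ℝ (Fin d)) : ℝ :=
  (f x₀ - ⨅ y, f y) + L * μ ^ 2 / 2

/-- `S_μ = (√(L Δ̄₀) + σ) / √d + L μ`. -/
def scale {d : ℕ} (L μ σ : ℝ) (f : EuclideanSpace ℝ (Fin d) → ℝ)
    (x₀ : EuclideanSpace ℝ (Fin d)) : ℝ :=
  (√(L * barGap L μ f x₀) + σ) / √(d : ℝ) + L * μ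

/-- Scalar clipping `ψ_τ(z) = z min {1, τ / |z|}`, with value `0` at `z = 0`. -/
def clip (τ z : ℝ) : ℝ := z * min 1 (τ / |z|)

/-- The two-point directional derivative estimate
`Y = (F(x + μ u; ξ) - F(x - μ u; ξ)) / (2 μ)`. -/
def twoPoint {d : ℕ} {Ξ : Type*} (μ : ℝ) (F : EuclideanSpace ℝ (Fin d) → Ξ → ℝ)
    (x u : EuclideanSpace ℝ (Fin d)) (ξ : Ξ) : ℝ :=
  (F (x + μ • u) ξ - F (x - μ • u) ξ) / (2 * μ)

/-- The scalar-clipped estimator `g(x) = (d / M) ∑_ℓ ψ_τ(Y_ℓ) u_ℓ` for given samples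
`(u_ℓ, ξ_ℓ)`, `ℓ = 1, …, M`. -/
def estimator {d : ℕ} {Ξ : Type*} (μ τ : ℝ) (F : EuclideanSpace ℝ (Fin d) → Ξ → ℝ) {M : ℕ}
    (u : Fin M → Metric.sphere (0 : EuclideanSpace ℝ (Fin d)) 1) (ξ : Fin M → Ξ)
    (x : EuclideanSpace ℝ (Fin d)) : EuclideanSpace ℝ (Fin d) :=
  ((d : ℝ) / (M : ℝ)) •
    ∑ l, clip τ (twoPoint μ F x (u l) (ξ l)) • (u l : EuclideanSpace ℝ (Fin d))

end ZerothOrder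

end

/-! The error splits into a sampling fluctuation and a clipping bias. The divergence theorem on the
unit ball (`integral_closedBall_fderiv`) gives `∇f_μ(x) = d E[Y u]`, so with `W = ψ_τ(Y) u` the
error equals `(d/M) ∑ (W_ℓ - E W)` plus `d E[(ψ_τ(Y) - Y) u]`.

Taylor expansion of the samples yields `|Y| ≤ A + B` almost surely, with the signal `A = |⟪∇f(x),
u⟫| + Lμ/2` and the projected noise `B = |⟪N, u⟫|`. A random direction sees only a `1/√d` share of a
vector, so both parts live at scale `S`: `E A² ≤ 16 S²`, because `‖∇f‖² ≤ 2L(f - f_*)`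
(`norm_gradient_sq_le`), and `B` keeps a weak-`L_p` tail of scale `σ/√d ≤ S`
(`prod_real_abs_inner_gt_le`). Integrating that tail beyond the clipping level bounds the bias and
produces `1/(p-1)` (`integral_max_sub_le`); integrating it below that level bounds `E‖W‖²` and
produces the logarithm (`integral_min_sq_le`).

The fluctuation is a sum of bounded centred vectors. `measure_norm_sum_gt_le` controls it with no
dimension factor, by following `E cosh‖·‖` along the partial sums.

With `k = (M/λ)^(1/p)` and `τ = 8Sk`, both errors have order `d S k^(1-p)`, which is the claimed
rate. -/

namespace ZerothOrder

/-! ### Isotropy and moments of the uniform law on the sphere. -/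

section Sphere

variable {d : ℕ}

lemma isProbabilityMeasure_unifSphere (hd : 1 ≤ d) : IsProbabilityMeasure (unifSphere d) := by
  have : Nonempty (Fin d) := ⟨⟨0, hd⟩⟩
  refine ⟨?_⟩
  rw [unifSphere, Measure.smul_apply, smul_eq_mul]
  refine ENNReal.inv_mul_cancel ?_ (measure_ne_top _ _)
  rw [Ne, Measure.measure_univ_eq_zero]
  exact Measure.toSphere_ne_zero _

/-- The surface measure of a set is unchanged by a linear isometry. -/
lemma toSphere_preimage_isometry (e : EuclideanSpace ℝ (Fin d) ≃ₗᵢ[ℝ] EuclideanSpace ℝ (Fin d))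
    {A : Set (EuclideanSpace ℝ (Fin d))} (hA : MeasurableSet A) :
    (volume : Measure (EuclideanSpace ℝ (Fin d))).toSphere (Subtype.val ⁻¹' (e ⁻¹' A)) =
      (volume : Measure (EuclideanSpace ℝ (Fin d))).toSphere (Subtype.val ⁻¹' A) := by
  have hA' : MeasurableSet (e ⁻¹' A) := e.continuous.measurable hA
  -- The surface measure of a set is the dimension times the volume of the cone over it, so the
  -- claim reduces to invariance of Lebesgue measure.
  rw [Measure.toSphere_apply' _ (measurable_subtype_coe hA'),
    Measure.toSphere_apply' _ (measurable_subtype_coe hA)]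
  congr 1
  refine Eq.trans ?_ (e.measurePreserving.measure_preimage_equiv (f := e.toMeasurableEquiv) _)
  congr 1
  ext v
  simp only [Set.mem_smul, Set.mem_preimage, Set.mem_image, Subtype.exists,
    mem_sphere_zero_iff_norm,
    exists_and_right, exists_eq_right]
  constructor
  · rintro ⟨r, hr, w, ⟨hw, hwA⟩, rfl⟩
    exact ⟨r, hr, e w, ⟨by simpa using hw, hwA⟩, (map_smul e r w).symm⟩
  · rintro ⟨r, hr, w, ⟨hw, hwA⟩, h⟩
    refine ⟨r, hr, e.symm w, ⟨by simpa using hw, by simpa using hwA⟩, ?_⟩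
    apply e.injective
    rw [map_smul, e.apply_symm_apply]
    exact h

/-- The uniform distribution on the sphere, seen as a measure on the ambient space, is invariant
under linear isometries. -/
lemma map_isometry_unifSphere (e : EuclideanSpace ℝ (Fin d) ≃ₗᵢ[ℝ] EuclideanSpace ℝ (Fin d)) :
    ((unifSphere d).map Subtype.val).map e = (unifSphere d).map Subtype.val := by
  ext A hA
  have hA' : MeasurableSet (e ⁻¹' A) := e.continuous.measurable hA
  rw [Measure.map_apply e.continuous.measurable hA, Measure.map_apply measurable_subtype_coe hA',
    Measure.map_apply measurable_subtype_coe hA, unifSphere, Measure.smul_apply, Measure.smul_apply,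
    toSphere_preimage_isometry e hA]

/-- The distribution of `⟪a, u⟫` depends only on `‖a‖`. -/
lemma map_inner_unifSphere {a b : EuclideanSpace ℝ (Fin d)} (hab : ‖a‖ = ‖b‖) :
    (unifSphere d).map (fun u : Metric.sphere (0 : EuclideanSpace ℝ (Fin d)) 1 =>
        inner ℝ a (u : EuclideanSpace ℝ (Fin d))) =
      (unifSphere d).map (fun u : Metric.sphere (0 : EuclideanSpace ℝ (Fin d)) 1 =>
        inner ℝ b (u : EuclideanSpace ℝ (Fin d))) := by
  have hma : Measurable fun v : EuclideanSpace ℝ (Fin d) => inner ℝ a v := by fun_prop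
  have hmb : Measurable fun v : EuclideanSpace ℝ (Fin d) => inner ℝ b v := by fun_prop
  -- Vectors of equal norm are exchanged by the reflection in the hyperplane orthogonal to their
  -- difference.
  set e := (Submodule.span ℝ {a - b})ᗮ.reflection
  have he : e a = b := Submodule.reflection_sub hab
  have h1 := Measure.map_map (μ := (unifSphere d)) hma measurable_subtype_coe
  have h2 := Measure.map_map (μ := (unifSphere d)) hmb measurable_subtype_coe
  simp only [Function.comp_def] at h1 h2
  rw [← h1, ← h2]
  conv_rhs => rw [← map_isometry_unifSphere e]
  rw [Measure.map_map hmb e.continuous.measurable]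
  congr 1
  ext v
  simp only [Function.comp]
  rw [← he, e.inner_map_map]

lemma norm_inner_sphere_le (a : EuclideanSpace ℝ (Fin d))
    (u : Metric.sphere (0 : EuclideanSpace ℝ (Fin d)) 1) :
    |inner ℝ a (u : EuclideanSpace ℝ (Fin d))| ≤ ‖a‖ := by
  have := abs_real_inner_le_norm a (u : EuclideanSpace ℝ (Fin d))
  simpa using this

lemma integrable_inner_sq_unifSphere (hd : 1 ≤ d) (a : EuclideanSpace ℝ (Fin d)) :
    Integrable (fun u : Metric.sphere (0 : EuclideanSpace ℝ (Fin d)) 1 =>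
      (inner ℝ a (u : EuclideanSpace ℝ (Fin d))) ^ 2) (unifSphere d) := by
  have := isProbabilityMeasure_unifSphere hd
  refine Integrable.of_bound (C := ‖a‖ ^ 2) (by fun_prop) (.of_forall fun u => ?_)
  rw [Real.norm_eq_abs, abs_pow]
  exact pow_le_pow_left₀ (abs_nonneg _) (norm_inner_sphere_le a u) 2

lemma integral_inner_sq_congr {a b : EuclideanSpace ℝ (Fin d)} (hab : ‖a‖ = ‖b‖) :
    ∫ u : Metric.sphere (0 : EuclideanSpace ℝ (Fin d)) 1,
      (inner ℝ a (u : EuclideanSpace ℝ (Fin d))) ^ 2 ∂(unifSphere d) =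
      ∫ u : Metric.sphere (0 : EuclideanSpace ℝ (Fin d)) 1,
      (inner ℝ b (u : EuclideanSpace ℝ (Fin d))) ^ 2 ∂(unifSphere d) := by
  rw [← integral_map (φ := fun u : Metric.sphere (0 : EuclideanSpace ℝ (Fin d)) 1 =>
      inner ℝ a (u : EuclideanSpace ℝ (Fin d))) (f := fun t : ℝ => t ^ 2) (by fun_prop)
      (by fun_prop), map_inner_unifSphere hab, integral_map (by fun_prop) (by fun_prop)]

/-- By isotropy `a` may be replaced by any `‖a‖ e_i` without changing the integral, and the `d`
equal integrals so obtained add up to `‖a‖²` because `‖u‖ = 1`. -/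
lemma integral_inner_sq_unifSphere (hd : 1 ≤ d) (a : EuclideanSpace ℝ (Fin d)) :
    ∫ u : Metric.sphere (0 : EuclideanSpace ℝ (Fin d)) 1,
      (inner ℝ a (u : EuclideanSpace ℝ (Fin d))) ^ 2 ∂(unifSphere d) = ‖a‖ ^ 2 / d := by
  have := isProbabilityMeasure_unifSphere hd
  have hd0 : (d : ℝ) ≠ 0 := by positivity
  have key : ∑ i : Fin d, ∫ u : Metric.sphere (0 : EuclideanSpace ℝ (Fin d)) 1,
      (inner ℝ (‖a‖ • EuclideanSpace.single i (1 : ℝ))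
      (u : EuclideanSpace ℝ (Fin d))) ^ 2 ∂(unifSphere d) = ‖a‖ ^ 2 := by
    rw [← integral_finsetSum _ fun i _ => integrable_inner_sq_unifSphere hd _]
    have : ∀ u : Metric.sphere (0 : EuclideanSpace ℝ (Fin d)) 1,
        ∑ i : Fin d, (inner ℝ (‖a‖ • EuclideanSpace.single i (1 : ℝ))
          (u : EuclideanSpace ℝ (Fin d))) ^ 2 = ‖a‖ ^ 2 := by
      intro u
      have h1 : ‖(u : EuclideanSpace ℝ (Fin d))‖ ^ 2 = 1 := by simp
      rw [EuclideanSpace.norm_sq_eq] at h1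
      simp only [inner_smul_left, EuclideanSpace.inner_single_left, mul_pow]
      simp only [Real.norm_eq_abs, sq_abs] at h1
      simp [← Finset.mul_sum, h1]
    simp [this]
  have h2 : ∀ i : Fin d, ∫ u : Metric.sphere (0 : EuclideanSpace ℝ (Fin d)) 1,
      (inner ℝ (‖a‖ • EuclideanSpace.single i (1 : ℝ))
      (u : EuclideanSpace ℝ (Fin d))) ^ 2 ∂(unifSphere d) =
      ∫ u : Metric.sphere (0 : EuclideanSpace ℝ (Fin d)) 1,
      (inner ℝ a (u : EuclideanSpace ℝ (Fin d))) ^ 2 ∂(unifSphere d) := fun i =>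
    integral_inner_sq_congr (by simp [norm_smul])
  simp only [h2, Finset.sum_const, Finset.card_univ, Fintype.card_fin, nsmul_eq_mul] at key
  rw [← key]
  field_simp

/-- Absolute moments of order `p ≤ 2` of a coordinate on the sphere. -/
lemma integral_abs_inner_rpow_unifSphere_le (hd : 1 ≤ d) {p : ℝ} (hp1 : 0 < p) (hp2 : p ≤ 2)
    {a : EuclideanSpace ℝ (Fin d)} (ha : ‖a‖ = 1) :
    ∫ u : Metric.sphere (0 : EuclideanSpace ℝ (Fin d)) 1,
      |inner ℝ a (u : EuclideanSpace ℝ (Fin d))| ^ p ∂(unifSphere d) ≤ (1 / √(d : ℝ)) ^ p := by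
  have := isProbabilityMeasure_unifSphere hd
  have hd0 : (0 : ℝ) < d := by positivity
  have hpt : ∀ u : Metric.sphere (0 : EuclideanSpace ℝ (Fin d)) 1,
      |inner ℝ a (u : EuclideanSpace ℝ (Fin d))| ^ p ≤ (1 / √(d : ℝ)) ^ p *
        (1 + p / 2 * (d * (inner ℝ a (u : EuclideanSpace ℝ (Fin d))) ^ 2 - 1)) := by
    intro u
    set t := inner ℝ a (u : EuclideanSpace ℝ (Fin d))
    -- Jensen through the tangent line of the concave power `p/2` at 1: the variable `d t² - 1` has
    -- mean zero, so the linear term integrates away.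
    have h1 : (1 + (d * t ^ 2 - 1)) ^ (p / 2) ≤ 1 + p / 2 * (d * t ^ 2 - 1) :=
      rpow_one_add_le_one_add_mul_self (by nlinarith [sq_nonneg t]) (by linarith) (by linarith)
    have h2 : |t| ^ p = (1 / √(d : ℝ)) ^ p * (1 + (d * t ^ 2 - 1)) ^ (p / 2) := by
      have : 1 + (d * t ^ 2 - 1) = (√d * |t|) ^ (2 : ℝ) := by
        rw [Real.rpow_two, mul_pow, Real.sq_sqrt hd0.le, sq_abs]; ring
      rw [this, ← Real.rpow_mul (by positivity), mul_div_cancel₀ _ two_ne_zero,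
        ← Real.mul_rpow (by positivity) (by positivity)]
      congr 1
      field_simp
    rw [h2]
    gcongr
  have hint := integrable_inner_sq_unifSphere hd a
  have hi2 : Integrable (fun u : Metric.sphere (0 : EuclideanSpace ℝ (Fin d)) 1 =>
      p / 2 * (d * (inner ℝ a (u : EuclideanSpace ℝ (Fin d))) ^ 2 - 1)) (unifSphere d) :=
    ((hint.const_mul _).sub (integrable_const _)).const_mul _
  have hi3 : Integrable (fun u : Metric.sphere (0 : EuclideanSpace ℝ (Fin d)) 1 =>
      1 + p / 2 * (d * (inner ℝ a (u : EuclideanSpace ℝ (Fin d))) ^ 2 - 1)) (unifSphere d) :=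
    (integrable_const _).add hi2
  refine (integral_mono_of_nonneg (.of_forall fun u => by positivity) (hi3.const_mul _)
    (.of_forall hpt)).trans_eq ?_
  rw [integral_const_mul, integral_add (integrable_const _) hi2, integral_const_mul,
    integral_sub (hint.const_mul _) (integrable_const _), integral_const_mul,
    integral_inner_sq_unifSphere hd a, ha]
  simp [hd0.ne']

end Sphere

/-! ### Polar coordinates and the divergence theorem on the unit ball. -/

section Divergence

variable {E : Type*} [NormedAddCommGroup E] [InnerProductSpace ℝ E] [FiniteDimensional ℝ E]
  [MeasurableSpace E] [BorelSpace E]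

lemma continuous_sphere_integral (m : Measure E) [m.IsAddHaarMeasure] {h : E → ℝ → ℝ}
    (hh : Continuous h.uncurry) :
    Continuous fun s : ℝ => ∫ u : Metric.sphere (0 : E) 1, h u s ∂m.toSphere := by
  have := continuous_parametric_integral_of_continuous (μ := m.toSphere)
    (f := fun (s : ℝ) (u : Metric.sphere (0 : E) 1) => h u s)
    (hh.comp (by fun_prop : Continuous fun q : ℝ × Metric.sphere (0 : E) 1 => ((q.2 : E), q.1)))
    (isCompact_univ)
  simpa using this

/-- Integration in polar coordinates over a ball. -/
lemma setIntegral_ball_eq_polar [Nontrivial E] (m : Measure E) [m.IsAddHaarMeasure] {h : E → ℝ}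
    (hh : Continuous h) {r : ℝ} (hr : 0 ≤ r) :
    ∫ v in Metric.ball (0 : E) r, h v ∂m =
      ∫ s in (0 : ℝ)..r, s ^ (Module.finrank ℝ E - 1) *
        ∫ u : Metric.sphere (0 : E) 1, h (s • (u : E)) ∂m.toSphere := by
  set k : E → ℝ := (Metric.ball (0 : E) r).indicator h with hk
  set f : Metric.sphere (0 : E) 1 × Set.Ioi (0 : ℝ) → ℝ := fun q => k ((q.2 : ℝ) • (q.1 : E))
    with hf
  have hkint : Integrable k m := by
    rw [hk, integrable_indicator_iff measurableSet_ball]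
    exact (hh.continuousOn.integrableOn_compact (isCompact_closedBall 0 r)).mono_set
      Metric.ball_subset_closedBall
  have hfk : ∀ x : ({0}ᶜ : Set E), f (homeomorphUnitSphereProd E x) = k x := by
    intro x
    have hx : ‖(x : E)‖ ≠ 0 := norm_ne_zero_iff.2 x.2
    simp only [hf, homeomorphUnitSphereProd_apply_snd_coe, homeomorphUnitSphereProd_apply_fst_coe]
    rw [smul_smul, mul_inv_cancel₀ hx, one_smul]
  have hmp := m.measurePreserving_homeomorphUnitSphereProd
  have hfint : Integrable f (m.toSphere.prod (.volumeIoiPow (Module.finrank ℝ E - 1))) := by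
    rw [← hmp.integrable_comp_emb (Homeomorph.measurableEmbedding _)]
    have : f ∘ (homeomorphUnitSphereProd E) = k ∘ Subtype.val := funext hfk
    rw [this, ← integrableOn_iff_comap_subtypeVal (by measurability)]
    exact hkint.integrableOn
  have hinner : ∀ s : ℝ, 0 < s → ∫ u : Metric.sphere (0 : E) 1, k (s • (u : E)) ∂m.toSphere =
      (Set.Iio r).indicator (fun s => ∫ u : Metric.sphere (0 : E) 1, h (s • (u : E)) ∂m.toSphere)
        s := by
    intro s hs
    by_cases hsr : s < r
    · simp [hk, Set.indicator, hsr, norm_smul, abs_of_pos hs]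
    · simp [hk, Set.indicator, hsr, norm_smul, abs_of_pos hs]
  calc ∫ v in Metric.ball (0 : E) r, h v ∂m = ∫ v, k v ∂m :=
        (integral_indicator measurableSet_ball).symm
    _ = ∫ x : ({0}ᶜ : Set E), k x ∂(m.comap (↑)) := by
        rw [integral_subtype_comap (measurableSet_singleton _).compl, restrict_compl_singleton]
    _ = ∫ q, f q ∂(m.toSphere.prod (.volumeIoiPow (Module.finrank ℝ E - 1))) := by
        rw [← hmp.integral_comp (Homeomorph.measurableEmbedding _)]
        exact integral_congr_ae (.of_forall fun x => (hfk x).symm)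
    _ = ∫ s : Set.Ioi (0 : ℝ), ∫ u : Metric.sphere (0 : E) 1, k ((s : ℝ) • (u : E)) ∂m.toSphere
          ∂(.volumeIoiPow (Module.finrank ℝ E - 1)) := by
        rw [integral_prod_symm _ hfint]
    _ = ∫ s : Set.Ioi (0 : ℝ), (Set.Iio r).indicator (fun s => ∫ u : Metric.sphere (0 : E) 1,
          h (s • (u : E)) ∂m.toSphere) s ∂(.volumeIoiPow (Module.finrank ℝ E - 1)) :=
        integral_congr_ae (.of_forall fun s => hinner s s.2)
    _ = ∫ s in Set.Ioi (0 : ℝ), s ^ (Module.finrank ℝ E - 1) * (Set.Iio r).indicator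
          (fun s => ∫ u : Metric.sphere (0 : E) 1, h (s • (u : E)) ∂m.toSphere) s := by
        simp only [Measure.volumeIoiPow, ENNReal.ofReal]
        rw [integral_withDensity_eq_integral_smul
          ((measurable_subtype_coe.pow_const _).real_toNNReal),
          integral_subtype_comap measurableSet_Ioi fun a ↦
            Real.toNNReal (a ^ (Module.finrank ℝ E - 1)) • (Set.Iio r).indicator
            (fun s => ∫ u : Metric.sphere (0 : E) 1, h (s • (u : E)) ∂m.toSphere) a]
        refine setIntegral_congr_fun measurableSet_Ioi fun x hx ↦ ?_
        simp only [NNReal.smul_def, Real.coe_toNNReal _ (pow_nonneg (le_of_lt hx) _), smul_eq_mul]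
    _ = ∫ s in Set.Ioi (0 : ℝ), (Set.Iio r).indicator (fun s => s ^ (Module.finrank ℝ E - 1) *
          ∫ u : Metric.sphere (0 : E) 1, h (s • (u : E)) ∂m.toSphere) s := by
        congr 1
        ext s
        simp [Set.indicator]
    _ = _ := by
        rw [setIntegral_indicator measurableSet_Iio, Set.Ioi_inter_Iio,
          intervalIntegral.integral_of_le hr, integral_Ioc_eq_integral_Ioo]

/-- Squaring removes the kink at 0. The weight `(r² - ‖v‖²)²`, extended by zero outside the ball, is
therefore differentiable everywhere, so integration by parts on the whole space has no boundary
term. -/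
lemma hasDerivAt_max_zero_sq (t : ℝ) : HasDerivAt (fun t : ℝ => (max 0 t) ^ 2) (2 * max 0 t) t := by
  rcases lt_trichotomy t 0 with h | rfl | h
  · have : (fun t : ℝ => (max 0 t) ^ 2) =ᶠ[nhds t] fun _ => 0 := by
      filter_upwards [Iio_mem_nhds h] with s hs
      rw [max_eq_left (le_of_lt hs)]; simp
    rw [max_eq_left h.le, mul_zero]
    exact (hasDerivAt_const t (0 : ℝ)).congr_of_eventuallyEq this
  · rw [max_self, mul_zero, hasDerivAt_iff_isLittleO]
    simp only [max_self, sub_zero, smul_zero, ne_eq, OfNat.ofNat_ne_zero, not_false_eq_true,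
      zero_pow]
    refine Asymptotics.IsBigO.trans_isLittleO (g := fun s : ℝ => s ^ 2) ?_ ?_
    · refine Asymptotics.IsBigO.of_bound 1 (.of_forall fun s => ?_)
      rw [one_mul, norm_pow, norm_pow]
      refine pow_le_pow_left₀ (norm_nonneg _) ?_ 2
      rw [Real.norm_eq_abs, Real.norm_eq_abs, abs_of_nonneg (le_max_left _ _)]
      exact max_le (abs_nonneg _) (le_abs_self _)
    · simpa using Asymptotics.isLittleO_pow_pow (𝕜 := ℝ) (one_lt_two)
  · have : (fun t : ℝ => (max 0 t) ^ 2) =ᶠ[nhds t] fun s => s ^ 2 := by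
      filter_upwards [Ioi_mem_nhds h] with s hs
      rw [max_eq_right (le_of_lt hs)]
    rw [max_eq_right h.le]
    have h2 : HasDerivAt (fun s : ℝ => s ^ 2) (2 * t) t := by simpa using hasDerivAt_pow 2 t
    exact h2.congr_of_eventuallyEq this

/-- Integration by parts on a ball against the weight `(r² - ‖v‖²)²`. -/
lemma integral_ball_weight_fderiv (m : Measure E) [m.IsAddHaarMeasure] {φ : E → ℝ}
    (hφ : ContDiff ℝ 1 φ) (e : E) (r : ℝ) :
    ∫ v in Metric.ball (0 : E) r, (r ^ 2 - ‖v‖ ^ 2) ^ 2 * fderiv ℝ φ v e ∂m =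
      ∫ v in Metric.ball (0 : E) r, 4 * (r ^ 2 - ‖v‖ ^ 2) * (φ v * inner ℝ v e) ∂m := by
  rcases le_or_gt r 0 with hr | hr
  · simp [Metric.ball_eq_empty.2 hr]
  set η : E → ℝ := fun v => (max 0 (r ^ 2 - ‖v‖ ^ 2)) ^ 2 with hη
  have hηd : ∀ v, HasFDerivAt η
      ((2 * max 0 (r ^ 2 - ‖v‖ ^ 2)) • (-(2 • innerSL ℝ v) : E →L[ℝ] ℝ)) v := by
    intro v
    have h1 : HasFDerivAt (fun v : E => r ^ 2 - ‖v‖ ^ 2)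
        (-(2 • innerSL ℝ v) : E →L[ℝ] ℝ) v :=
      ((hasStrictFDerivAt_norm_sq v).hasFDerivAt).const_sub _
    exact (hasDerivAt_max_zero_sq _).comp_hasFDerivAt v h1
  have hηf : ∀ v, fderiv ℝ η v e = -(4 * max 0 (r ^ 2 - ‖v‖ ^ 2) * inner ℝ v e) := by
    intro v
    rw [(hηd v).fderiv]
    simp
    ring
  have hφ' : Continuous fun v => fderiv ℝ φ v e :=
    (hφ.continuous_fderiv (by norm_num)).clm_apply continuous_const
  have hzero : ∀ v, v ∉ Metric.ball (0 : E) r → max 0 (r ^ 2 - ‖v‖ ^ 2) = 0 := by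
    intro v hv
    rw [mem_ball_zero_iff, not_lt] at hv
    refine max_eq_left ?_
    nlinarith
  have hpos : ∀ v, v ∈ Metric.ball (0 : E) r → max 0 (r ^ 2 - ‖v‖ ^ 2) = r ^ 2 - ‖v‖ ^ 2 := by
    intro v hv
    rw [mem_ball_zero_iff] at hv
    refine max_eq_right ?_
    nlinarith [norm_nonneg v]
  have hcs : ∀ {g : E → ℝ}, Continuous g → (∀ v, v ∉ Metric.ball (0 : E) r → g v = 0) →
      Integrable g m := by
    intro g hg hg0
    refine hg.integrable_of_hasCompactSupport
      (HasCompactSupport.intro (isCompact_closedBall (0 : E) r) fun v hv => hg0 v fun h =>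
        hv (Metric.ball_subset_closedBall h))
  have hibp := integral_mul_fderiv_eq_neg_fderiv_mul_of_integrable (μ := m) (f := φ) (g := η)
    (v := e)
    (hcs (by fun_prop) fun v hv => by simp [hη, hzero v hv])
    (hcs (by simp only [hηf]; have := hφ.continuous; fun_prop)
      fun v hv => by simp [hηf, hzero v hv])
    (hcs (by have := hφ.continuous; fun_prop) fun v hv => by simp [hη, hzero v hv])
    (fun v _ => (hφ.differentiable (by norm_num)).differentiableAt)
    (fun v _ => (hηd v).differentiableAt)
  have e1 : ∫ v in Metric.ball (0 : E) r, (r ^ 2 - ‖v‖ ^ 2) ^ 2 * fderiv ℝ φ v e ∂m =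
      ∫ v, fderiv ℝ φ v e * η v ∂m := by
    rw [← setIntegral_eq_integral_of_forall_compl_eq_zero (s := Metric.ball (0 : E) r)
      (f := fun v => fderiv ℝ φ v e * η v) fun v hv => by simp [hη, hzero v hv]]
    refine setIntegral_congr_fun measurableSet_ball fun v hv => ?_
    simp only [hη, hpos v hv]
    ring
  have e2 : ∫ v in Metric.ball (0 : E) r, 4 * (r ^ 2 - ‖v‖ ^ 2) * (φ v * inner ℝ v e) ∂m =
      -∫ v, φ v * fderiv ℝ η v e ∂m := by
    rw [← integral_neg, ← setIntegral_eq_integral_of_forall_compl_eq_zero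
      (s := Metric.ball (0 : E) r) (f := fun v => -(φ v * fderiv ℝ η v e))
      fun v hv => by simp [hηf, hzero v hv]]
    refine setIntegral_congr_fun measurableSet_ball fun v hv => ?_
    simp only [hηf, hpos v hv]
    ring
  rw [e1, e2, hibp, neg_neg]

/-- Differentiating twice in `r` strips off the weights. They vanish at `s = r`, so each time the
endpoint terms on the weighted integrals cancel; what is left after the second differentiation is
the unweighted integral of `A` against the endpoint value of `B`. -/
lemma integral_eq_of_weighted_integral_eq {A B : ℝ → ℝ} (hA : Continuous A) (hB : Continuous B)
    (h : ∀ r : ℝ, 0 < r → ∫ s in (0 : ℝ)..r, (r ^ 2 - s ^ 2) ^ 2 * A s =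
      ∫ s in (0 : ℝ)..r, 4 * (r ^ 2 - s ^ 2) * B s) {r : ℝ} (hr : 0 < r) :
    r * ∫ s in (0 : ℝ)..r, A s = B r := by
  have hii : ∀ {g : ℝ → ℝ} (r : ℝ), Continuous g → IntervalIntegrable g volume 0 r :=
    fun r hg => hg.intervalIntegrable _ _
  have hd : ∀ {g : ℝ → ℝ} (r : ℝ), Continuous g →
      HasDerivAt (fun r => ∫ s in (0 : ℝ)..r, g s) (g r) r := fun r hg =>
    intervalIntegral.integral_hasDerivAt_right (hii r hg) (hg.stronglyMeasurableAtFilter _ _)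
      hg.continuousAt
  have hA2 : Continuous fun s => s ^ 2 * A s := by fun_prop
  have hA4 : Continuous fun s => s ^ 4 * A s := by fun_prop
  have hB2 : Continuous fun s => s ^ 2 * B s := by fun_prop
  have eL : ∀ r : ℝ, ∫ s in (0 : ℝ)..r, (r ^ 2 - s ^ 2) ^ 2 * A s =
      r ^ 4 * (∫ s in (0 : ℝ)..r, A s) - 2 * r ^ 2 * (∫ s in (0 : ℝ)..r, s ^ 2 * A s) +
        ∫ s in (0 : ℝ)..r, s ^ 4 * A s := by
    intro r
    rw [← intervalIntegral.integral_const_mul, ← intervalIntegral.integral_const_mul,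
      ← intervalIntegral.integral_sub (hii r (by fun_prop)) (hii r (by fun_prop)),
      ← intervalIntegral.integral_add (hii r (by fun_prop)) (hii r (by fun_prop))]
    congr 1; ext s; ring
  have eR : ∀ r : ℝ, ∫ s in (0 : ℝ)..r, 4 * (r ^ 2 - s ^ 2) * B s =
      4 * r ^ 2 * (∫ s in (0 : ℝ)..r, B s) - 4 * ∫ s in (0 : ℝ)..r, s ^ 2 * B s := by
    intro r
    rw [← intervalIntegral.integral_const_mul, ← intervalIntegral.integral_const_mul,
      ← intervalIntegral.integral_sub (hii r (by fun_prop)) (hii r (by fun_prop))]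
    congr 1; ext s; ring
  have step1 : ∀ r : ℝ, 0 < r → r ^ 2 * (∫ s in (0 : ℝ)..r, A s) -
      ∫ s in (0 : ℝ)..r, s ^ 2 * A s = 2 * ∫ s in (0 : ℝ)..r, B s := by
    intro r hr
    have d1 := (((hasDerivAt_pow 4 r).mul (hd r hA)).sub
      (((hasDerivAt_pow 2 r).const_mul 2).mul (hd r hA2))).add (hd r hA4)
    have d2 := (((hasDerivAt_pow 2 r).const_mul 4).mul (hd r hB)).sub ((hd r hB2).const_mul 4)
    have := d1.unique (d2.congr_of_eventuallyEq (by
      filter_upwards [Ioi_mem_nhds hr] with q hq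
      simpa [eL, eR] using h q hq))
    norm_num at this
    -- Both first derivatives carry the common factor `4r`, cancelled because `r > 0`.
    have h4 : (4 * r) * (r ^ 2 * (∫ s in (0 : ℝ)..r, A s) - ∫ s in (0 : ℝ)..r, s ^ 2 * A s) =
        (4 * r) * (2 * ∫ s in (0 : ℝ)..r, B s) := by linear_combination this
    exact mul_left_cancel₀ (by positivity) h4
  have d1 := ((hasDerivAt_pow 2 r).mul (hd r hA)).sub (hd r hA2)
  have d2 := (hd r hB).const_mul 2
  have := d1.unique (d2.congr_of_eventuallyEq (by
    filter_upwards [Ioi_mem_nhds hr] with q hq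
    simpa using step1 q hq))
  norm_num at this
  linear_combination this / 2

/-- The divergence theorem on the unit ball. -/
theorem integral_closedBall_fderiv [Nontrivial E] (m : Measure E) [m.IsAddHaarMeasure] {φ : E → ℝ}
    (hφ : ContDiff ℝ 1 φ) (e : E) :
    ∫ v in Metric.closedBall (0 : E) 1, fderiv ℝ φ v e ∂m =
      ∫ u : Metric.sphere (0 : E) 1, φ u * inner ℝ (u : E) e ∂m.toSphere := by
  have hφ' : Continuous fun v => fderiv ℝ φ v e :=
    (hφ.continuous_fderiv (by norm_num)).clm_apply continuous_const
  have hφc := hφ.continuous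
  have hn : Module.finrank ℝ E - 1 + 1 = Module.finrank ℝ E :=
    Nat.sub_add_cancel Module.finrank_pos
  set n := Module.finrank ℝ E
  set a : ℝ → ℝ := fun s => ∫ u : Metric.sphere (0 : E) 1, fderiv ℝ φ (s • (u : E)) e ∂m.toSphere
    with ha
  set b : ℝ → ℝ := fun s => ∫ u : Metric.sphere (0 : E) 1, φ (s • (u : E)) * inner ℝ (u : E) e
    ∂m.toSphere with hb
  have hac : Continuous a := continuous_sphere_integral m
    (h := fun u s => fderiv ℝ φ (s • u) e)
    (hφ'.comp (by fun_prop : Continuous fun q : E × ℝ => q.2 • q.1))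
  have hbc : Continuous b := continuous_sphere_integral m
    (h := fun u s => φ (s • u) * inner ℝ u e)
    (by simp only [Function.uncurry_def]; fun_prop)
  have key := integral_eq_of_weighted_integral_eq (A := fun s => s ^ (n - 1) * a s)
    -- The Jacobian is `s^(n-1)`; the extra power of `s` comes from `⟪s u, e⟫ = s ⟪u, e⟫`.
    (B := fun s => s ^ n * b s) (by fun_prop) (by fun_prop) (fun r hr => by
      have h1 := setIntegral_ball_eq_polar m (r := r)
        (h := fun v => (r ^ 2 - ‖v‖ ^ 2) ^ 2 * fderiv ℝ φ v e) (by fun_prop) hr.le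
      have h2 := setIntegral_ball_eq_polar m (r := r)
        (h := fun v => 4 * (r ^ 2 - ‖v‖ ^ 2) * (φ v * inner ℝ v e)) (by fun_prop) hr.le
      rw [integral_ball_weight_fderiv m hφ e r, h2] at h1
      refine Eq.trans ?_ (h1.symm.trans ?_)
      · refine intervalIntegral.integral_congr fun s _ => ?_
        simp only [norm_smul, norm_eq_of_mem_sphere, mul_one, Real.norm_eq_abs, sq_abs,
          integral_const_mul, ha]
        ring
      · refine intervalIntegral.integral_congr fun s _ => ?_
        simp only [norm_smul, norm_eq_of_mem_sphere, mul_one, Real.norm_eq_abs, sq_abs,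
          integral_const_mul, hb, inner_smul_left, conj_trivial]
        have : ∀ u : Metric.sphere (0 : E) 1, φ (s • (u : E)) * (s * inner ℝ (u : E) e) =
          s * (φ (s • (u : E)) * inner ℝ (u : E) e) := fun u => by ring
        simp only [this, integral_const_mul]
        have hp : s ^ n = s ^ (n - 1) * s := by rw [← pow_succ, hn]
        rw [hp]
        ring) one_pos
  have hball : (Metric.closedBall (0 : E) 1 : Set E) =ᵐ[m] Metric.ball (0 : E) 1 := by
    rw [← Metric.ball_union_sphere]
    exact union_ae_eq_left_of_ae_eq_empty (ae_eq_empty.2 (Measure.addHaar_sphere m 0 1))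
  rw [setIntegral_congr_set hball]
  rw [setIntegral_ball_eq_polar m hφ' zero_le_one]
  simpa [ha, hb] using key

end Divergence

/-! ### Dimension-free concentration in Hilbert space through `cosh` of the norm. -/

section Concentration

lemma cosh_sqrt_hasSum {w : ℝ} (hw : 0 ≤ w) :
    HasSum (fun n : ℕ => w ^ n / ((2 * n).factorial : ℝ)) (Real.cosh √w) := by
  have := Real.hasSum_cosh √w
  simpa only [pow_mul, Real.sq_sqrt hw] using this

/-- `cosh ∘ √` is convex on `[0, ∞)`. -/
lemma convexOn_cosh_sqrt : ConvexOn ℝ (Set.Ici 0) fun w : ℝ => Real.cosh √w := by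
  refine ⟨convex_Ici 0, fun x hx y hy a b ha hb hab => ?_⟩
  have hx' : (0 : ℝ) ≤ x := hx
  have hy' : (0 : ℝ) ≤ y := hy
  -- The power series in `w` has nonnegative coefficients, so convexity can be checked term by term.
  refine hasSum_le (fun n => ?_) (cosh_sqrt_hasSum (by simp only [smul_eq_mul]; positivity))
    (((cosh_sqrt_hasSum hx').const_smul a).add ((cosh_sqrt_hasSum hy').const_smul b))
  have := (convexOn_pow (𝕜 := ℝ) n).2 hx hy ha hb hab
  simp only [smul_eq_mul] at this ⊢
  calc _ ≤ (a * x ^ n + b * y ^ n) / ((2 * n).factorial : ℝ) := by gcongr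
    _ = _ := by ring

/-- The argument of the root is the average of `(a + b)²` and `(a - b)²` with weights `(1 ± c)/2`,
so convexity gives `cosh a cosh b + c sinh a sinh b`. Replacing `sinh b` by `b` in the last term
costs at most `(sinh b - b) cosh a`, and `cosh b + sinh b = exp b`. -/
lemma cosh_law_of_cosines_le {a b c : ℝ} (ha : 0 ≤ a) (hb : 0 ≤ b) (hc : |c| ≤ 1) :
    Real.cosh √(a ^ 2 + 2 * (a * b * c) + b ^ 2) ≤
      Real.cosh a + b * c * Real.sinh a + (Real.exp b - 1 - b) * Real.cosh a := by
  obtain ⟨hc1, hc2⟩ := abs_le.1 hc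
  have hconv := convexOn_cosh_sqrt.2 (Set.mem_Ici.2 (sq_nonneg (a + b)))
    (Set.mem_Ici.2 (sq_nonneg (a - b))) (by linarith : 0 ≤ (1 + c) / 2)
    (by linarith : 0 ≤ (1 - c) / 2) (by ring)
  have harg : ((1 + c) / 2) • (a + b) ^ 2 + ((1 - c) / 2) • (a - b) ^ 2 =
      a ^ 2 + 2 * (a * b * c) + b ^ 2 := by
    simp only [smul_eq_mul]; ring
  simp only [harg] at hconv
  simp only [Real.sqrt_sq_eq_abs, Real.cosh_abs, smul_eq_mul, Real.cosh_add, Real.cosh_sub] at hconv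
  have hs : Real.sinh a ≤ Real.cosh a := (Real.sinh_lt_cosh a).le
  have hs0 : 0 ≤ Real.sinh a := Real.sinh_nonneg_iff.2 ha
  have hsb : b ≤ Real.sinh b := Real.self_le_sinh_iff.2 hb
  have hexp : Real.exp b = Real.cosh b + Real.sinh b := (Real.cosh_add_sinh b).symm
  rw [hexp]
  nlinarith [mul_le_mul hs (le_refl (Real.sinh b - b)) (by linarith)
      (by linarith [Real.cosh_pos a]),
    mul_nonneg hs0 (sub_nonneg.2 hsb), mul_nonneg (sub_nonneg.2 hs) (sub_nonneg.2 hsb),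
    mul_nonneg (mul_nonneg hs0 (sub_nonneg.2 hsb)) (sub_nonneg.2 hc2)]

variable {E : Type*} [NormedAddCommGroup E] [InnerProductSpace ℝ E]

/-- This is a first-order expansion of `cosh‖·‖` at `x`: the term linear in `y` disappears on
averaging a centred `y`, and the remainder depends on `‖y‖` alone, whatever the dimension. At `x =
0` the quotient is read as 0, consistently with the vanishing inner product. -/
lemma cosh_norm_add_le (x y : E) :
    Real.cosh ‖x + y‖ ≤ Real.cosh ‖x‖ + (Real.sinh ‖x‖ / ‖x‖) * inner ℝ x y +
      (Real.exp ‖y‖ - 1 - ‖y‖) * Real.cosh ‖x‖ := by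
  have key := cosh_law_of_cosines_le (norm_nonneg x) (norm_nonneg y)
    (abs_real_inner_div_norm_mul_norm_le_one x y)
  have h1 : ‖x‖ * ‖y‖ * (inner ℝ x y / (‖x‖ * ‖y‖)) = inner ℝ x y := by
    rcases eq_or_ne (‖x‖ * ‖y‖) 0 with h | h
    · rw [h, zero_mul]
      exact (abs_nonpos_iff.1 ((abs_real_inner_le_norm x y).trans_eq h)).symm
    · exact mul_div_cancel₀ _ h
  have h2 : ‖y‖ * (inner ℝ x y / (‖x‖ * ‖y‖)) * Real.sinh ‖x‖ =
      (Real.sinh ‖x‖ / ‖x‖) * inner ℝ x y := by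
    rcases eq_or_ne ‖x‖ 0 with h | h
    · simp [h]
    · rcases eq_or_ne ‖y‖ 0 with h' | h'
      · simp [norm_eq_zero.1 h']
      · field_simp
  rw [h1, h2, ← norm_add_sq_real, Real.sqrt_sq (norm_nonneg _)] at key
  exact key

variable [MeasurableSpace E] [BorelSpace E] [FiniteDimensional ℝ E]
variable {Ω : Type*} [MeasurableSpace Ω] {Pr : Measure Ω} [IsProbabilityMeasure Pr]

lemma exp_sub_le_sq {b : ℝ} (hb0 : 0 ≤ b) (hb1 : b ≤ 1) : Real.exp b - 1 - b ≤ b ^ 2 := by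
  have := Real.abs_exp_sub_one_sub_id_le (x := b) (by rwa [abs_of_nonneg hb0])
  exact (le_abs_self _).trans this

lemma integrable_of_norm_le_one {X : Ω → E} (hX : AEMeasurable X Pr) (hb : ∀ᵐ ω ∂Pr, ‖X ω‖ ≤ 1) :
    Integrable X Pr :=
  Integrable.of_bound hX.aestronglyMeasurable 1 hb

lemma integrable_cosh_norm_of_bound {X : Ω → E} (hX : AEMeasurable X Pr) {C : ℝ}
    (hb : ∀ᵐ ω ∂Pr, ‖X ω‖ ≤ C) : Integrable (fun ω => Real.cosh ‖X ω‖) Pr := by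
  refine Integrable.of_bound (by fun_prop) (Real.cosh C) ?_
  filter_upwards [hb] with ω hω
  rw [Real.norm_eq_abs, abs_of_pos (Real.cosh_pos _)]
  exact Real.cosh_le_cosh.2 (by rwa [abs_of_nonneg (norm_nonneg _),
    abs_of_nonneg ((norm_nonneg _).trans hω)])

/-- One step of the exponential supermartingale bound for sums of independent vectors. -/
lemma integral_cosh_norm_add_le {X Y : Ω → E} (hX : AEMeasurable X Pr) (hY : AEMeasurable Y Pr)
    {C : ℝ} (hXb : ∀ᵐ ω ∂Pr, ‖X ω‖ ≤ C) (hYb : ∀ᵐ ω ∂Pr, ‖Y ω‖ ≤ 1) (hY0 : ∫ ω, Y ω ∂Pr = 0)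
    (hXY : IndepFun X Y Pr) {V : ℝ} (hV : ∫ ω, ‖Y ω‖ ^ 2 ∂Pr ≤ V) :
    ∫ ω, Real.cosh ‖X ω + Y ω‖ ∂Pr ≤ (1 + V) * ∫ ω, Real.cosh ‖X ω‖ ∂Pr := by
  have hprod := (indepFun_iff_map_prod_eq_prod_map_map hX hY).1 hXY
  have hPX : IsProbabilityMeasure (Pr.map X) := Measure.isProbabilityMeasure_map hX
  have hPY : IsProbabilityMeasure (Pr.map Y) := Measure.isProbabilityMeasure_map hY
  have hYi : Integrable (fun y : E => y) (Pr.map Y) :=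
    (integrable_map_measure (by fun_prop) hY).2 (integrable_of_norm_le_one hY hYb)
  have hYb' : ∀ᵐ y ∂(Pr.map Y), ‖y‖ ≤ 1 :=
    (ae_map_iff hY (measurableSet_le (by fun_prop) (by fun_prop))).2 hYb
  have hY2 : Integrable (fun y : E => ‖y‖ ^ 2) (Pr.map Y) := by
    refine Integrable.of_bound (by fun_prop) 1 ?_
    filter_upwards [hYb'] with y hy
    rw [norm_pow, norm_norm]
    exact pow_le_one₀ (norm_nonneg _) hy
  have hV' : ∫ y, ‖y‖ ^ 2 ∂(Pr.map Y) ≤ V := by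
    rwa [integral_map hY (by fun_prop)]
  have hY0' : ∫ y, y ∂(Pr.map Y) = 0 := by
    rwa [integral_map hY (by fun_prop)]
  have hint : Integrable (fun q : E × E => Real.cosh ‖q.1 + q.2‖) ((Pr.map X).prod (Pr.map Y)) := by
    rw [← hprod, integrable_map_measure (by fun_prop) (hX.prodMk hY)]
    refine integrable_cosh_norm_of_bound (hX.add hY) (C := C + 1) ?_
    filter_upwards [hXb, hYb] with ω h1 h2
    exact (norm_add_le _ _).trans (add_le_add h1 h2)
  have hXi : Integrable (fun x : E => Real.cosh ‖x‖) (Pr.map X) :=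
    (integrable_map_measure (by fun_prop) hX).2 (integrable_cosh_norm_of_bound hX hXb)
  calc ∫ ω, Real.cosh ‖X ω + Y ω‖ ∂Pr
      = ∫ q, Real.cosh ‖q.1 + q.2‖ ∂((Pr.map X).prod (Pr.map Y)) := by
        rw [← hprod, integral_map (hX.prodMk hY) (by fun_prop)]
    _ = ∫ x, ∫ y, Real.cosh ‖x + y‖ ∂(Pr.map Y) ∂(Pr.map X) := integral_prod _ hint
    _ ≤ ∫ x, (1 + V) * Real.cosh ‖x‖ ∂(Pr.map X) := by
        refine integral_mono hint.integral_prod_left (hXi.const_mul _) fun x => ?_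
        have hinner : Integrable (fun y : E => inner ℝ x y) (Pr.map Y) := hYi.const_inner x
        have hint0 : ∫ y, inner ℝ x y ∂(Pr.map Y) = 0 := by
          rw [integral_inner hYi, hY0', inner_zero_right]
        have hR : Integrable (fun y : E => Real.cosh ‖x‖ + (Real.sinh ‖x‖ / ‖x‖) * inner ℝ x y +
            ‖y‖ ^ 2 * Real.cosh ‖x‖) (Pr.map Y) :=
          ((integrable_const _).add (hinner.const_mul _)).add (hY2.mul_const _)
        calc ∫ y, Real.cosh ‖x + y‖ ∂(Pr.map Y)
            ≤ ∫ y, (Real.cosh ‖x‖ + (Real.sinh ‖x‖ / ‖x‖) * inner ℝ x y +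
              ‖y‖ ^ 2 * Real.cosh ‖x‖) ∂(Pr.map Y) := by
              refine integral_mono_of_nonneg (.of_forall fun y => (Real.cosh_pos _).le) hR ?_
              filter_upwards [hYb'] with y hy
              refine (cosh_norm_add_le x y).trans ?_
              gcongr
              exact exp_sub_le_sq (norm_nonneg y) hy
          _ = Real.cosh ‖x‖ + (∫ y, ‖y‖ ^ 2 ∂(Pr.map Y)) * Real.cosh ‖x‖ := by
              have hR1 : Integrable (fun y : E => Real.cosh ‖x‖ +
                  (Real.sinh ‖x‖ / ‖x‖) * inner ℝ x y) (Pr.map Y) :=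
                (integrable_const _).add (hinner.const_mul _)
              rw [integral_add hR1 (hY2.mul_const _),
                integral_add (integrable_const _) (hinner.const_mul _), integral_const_mul, hint0,
                integral_mul_const]
              simp
          _ ≤ (1 + V) * Real.cosh ‖x‖ := by
              nlinarith [Real.cosh_pos ‖x‖]
    _ = (1 + V) * ∫ ω, Real.cosh ‖X ω‖ ∂Pr := by
        rw [integral_const_mul, integral_map hX (by fun_prop)]

/-- Each independent summand multiplies the expectation by at most `1 + V ≤ exp V`. -/
lemma integral_cosh_norm_sum_le {ι : Type*} {X : ι → Ω → E}
    (hX : ∀ i, AEMeasurable (X i) Pr) (hb : ∀ i, ∀ᵐ ω ∂Pr, ‖X i ω‖ ≤ 1)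
    (h0 : ∀ i, ∫ ω, X i ω ∂Pr = 0) (hind : iIndepFun X Pr) {V : ℝ}
    (hV : ∀ i, ∫ ω, ‖X i ω‖ ^ 2 ∂Pr ≤ V) (s : Finset ι) :
    ∫ ω, Real.cosh ‖∑ i ∈ s, X i ω‖ ∂Pr ≤ Real.exp (s.card * V) := by
  classical
  induction s using Finset.induction_on with
  | empty => simp
  | insert i s his ih =>
    have hV0 : 0 ≤ V := (integral_nonneg fun ω => by positivity).trans (hV i)
    have hSb : ∀ᵐ ω ∂Pr, ‖∑ j ∈ s, X j ω‖ ≤ s.card := by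
      have : ∀ᵐ ω ∂Pr, ∀ j ∈ s, ‖X j ω‖ ≤ 1 := (Finset.eventually_all s).2 fun j _ => hb j
      filter_upwards [this] with ω hω
      refine (norm_sum_le _ _).trans ((Finset.sum_le_sum hω).trans_eq (by simp))
    have hSm : AEMeasurable (fun ω => ∑ j ∈ s, X j ω) Pr := by fun_prop
    have hindep : IndepFun (fun ω => ∑ j ∈ s, X j ω) (X i) Pr := by
      have := hind.indepFun_finsetSum_of_notMem₀ hX his
      convert this using 1
      ext ω
      simp
    have := integral_cosh_norm_add_le hSm (hX i) hSb (hb i) (h0 i) hindep (hV i)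
    have heq : ∀ ω, ∑ j ∈ insert i s, X j ω = (∑ j ∈ s, X j ω) + X i ω := fun ω => by
      rw [Finset.sum_insert his, add_comm]
    simp only [heq]
    refine this.trans ?_
    rw [Finset.card_insert_of_notMem his, Nat.cast_succ,
      show ((s.card : ℝ) + 1) * V = V + s.card * V by ring, Real.exp_add]
    refine mul_le_mul ?_ ih (integral_nonneg fun ω => (Real.cosh_pos _).le) (Real.exp_pos _).le
    rw [add_comm]
    exact Real.add_one_le_exp V

/-- A dimension-free Bernstein-type tail bound for sums of bounded centered independent vectors. -/
theorem measure_norm_sum_gt_le {ι : Type*} [Fintype ι] {X : ι → Ω → E}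
    (hX : ∀ i, AEMeasurable (X i) Pr) (hb : ∀ i, ∀ᵐ ω ∂Pr, ‖X i ω‖ ≤ 1)
    (h0 : ∀ i, ∫ ω, X i ω ∂Pr = 0) (hind : iIndepFun X Pr) {V : ℝ}
    (hV : ∀ i, ∫ ω, ‖X i ω‖ ^ 2 ∂Pr ≤ V) (t : ℝ) :
    Pr.real {ω | t < ‖∑ i, X i ω‖} ≤ 2 * Real.exp (Fintype.card ι * V - t) := by
  have hSm : AEMeasurable (fun ω => ∑ j, X j ω) Pr := by fun_prop
  have hSb : ∀ᵐ ω ∂Pr, ‖∑ j, X j ω‖ ≤ Fintype.card ι := by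
    have : ∀ᵐ ω ∂Pr, ∀ j, ‖X j ω‖ ≤ 1 := ae_all_iff.2 hb
    filter_upwards [this] with ω hω
    refine (norm_sum_le _ _).trans ((Finset.sum_le_sum fun j _ => hω j).trans_eq (by simp))
  -- Markov at level `exp t / 2`, which `cosh` exceeds beyond `t`; this is the source of the
  -- prefactor 2.
  have hmarkov := mul_meas_ge_le_integral_of_nonneg (μ := Pr)
    (f := fun ω => Real.cosh ‖∑ i, X i ω‖) (.of_forall fun ω => (Real.cosh_pos _).le)
    (integrable_cosh_norm_of_bound hSm hSb) (Real.exp t / 2)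
  have hsub : Pr.real {ω | t < ‖∑ i, X i ω‖} ≤
      Pr.real {ω | Real.exp t / 2 ≤ Real.cosh ‖∑ i, X i ω‖} := by
    refine measureReal_mono fun ω (hω : t < _) => ?_
    rw [Set.mem_ofPred_eq, Real.cosh_eq]
    have := Real.exp_le_exp.2 hω.le
    have := Real.exp_pos (-‖∑ i, X i ω‖)
    linarith
  have hsum := integral_cosh_norm_sum_le hX hb h0 hind hV Finset.univ
  rw [Finset.card_univ] at hsum
  rw [Real.exp_sub]
  have he := Real.exp_pos t
  rw [mul_div_assoc', le_div_iff₀ he]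
  have := hmarkov.trans hsum
  nlinarith

end Concentration

/-! ### Functions with Lipschitz gradient. -/

section Smooth

variable {E : Type*} [NormedAddCommGroup E] [InnerProductSpace ℝ E] [CompleteSpace E]

/-- The quadratic Taylor bound for a function with Lipschitz gradient. -/
lemma abs_sub_sub_inner_gradient_le {h : E → ℝ} (hd : Differentiable ℝ h) {L : ℝ}
    (hL : ∀ y z, ‖gradient h y - gradient h z‖ ≤ L * ‖y - z‖) (y w : E) :
    |h (y + w) - h y - inner ℝ (gradient h y) w| ≤ L / 2 * ‖w‖ ^ 2 := by
  set g : ℝ → ℝ := fun t => h (y + t • w) - h y - t * inner ℝ (gradient h y) w with hg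
  have hline : ∀ t : ℝ, HasDerivAt (fun t : ℝ => y + t • w) w t := fun t => by
    simpa using ((hasDerivAt_id t).smul_const w).const_add y
  have hg' : ∀ t, HasDerivAt g (inner ℝ (gradient h (y + t • w) - gradient h y) w) t := by
    intro t
    have h1 := ((hd (y + t • w)).hasGradientAt.hasFDerivAt).comp_hasDerivAt t (hline t)
    have h2 := (h1.sub_const (h y)).sub ((hasDerivAt_id t).mul_const (inner ℝ (gradient h y) w))
    convert! h2 using 1
    simp [inner_sub_left]
  have hB : ∀ t : ℝ, HasDerivAt (fun t : ℝ => L / 2 * ‖w‖ ^ 2 * t ^ 2) (L * ‖w‖ ^ 2 * t) t := by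
    intro t
    convert! (hasDerivAt_pow 2 t).const_mul (L / 2 * ‖w‖ ^ 2) using 1
    norm_num
    ring
  have := image_norm_le_of_norm_deriv_right_le_deriv_boundary (a := 0) (b := 1) (f := g)
    (fun t _ => (hg' t).continuousAt.continuousWithinAt)
    (fun t _ => (hg' t).hasDerivWithinAt) (B := fun t : ℝ => L / 2 * ‖w‖ ^ 2 * t ^ 2)
    (by simp [hg]) hB (fun t ht => ?_) (Set.right_mem_Icc.2 zero_le_one)
  · simpa [hg] using this
  · refine (norm_inner_le_norm _ _).trans ?_
    have h1 := hL (y + t • w) y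
    rw [add_sub_cancel_left, norm_smul, Real.norm_eq_abs, abs_of_nonneg ht.1] at h1
    calc _ ≤ (L * (t * ‖w‖)) * ‖w‖ := by gcongr
      _ = _ := by ring

/-- A quadratic Taylor bound with uniform constant survives averaging. Through this criterion it
identifies the gradients of both the smoothing and the objective, in place of differentiation under
the integral sign. -/
lemma hasGradientAt_of_quadratic_bound {h : E → ℝ} {y g : E} {C : ℝ}
    (hb : ∀ w, |h (y + w) - h y - inner ℝ g w| ≤ C * ‖w‖ ^ 2) : HasGradientAt h g y := by
  rw [hasGradientAt_iff_hasFDerivAt, hasFDerivAt_iff_isLittleO_nhds_zero]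
  refine Asymptotics.IsBigO.trans_isLittleO (g := fun w : E => ‖w‖ ^ 2) ?_ ?_
  · refine Asymptotics.IsBigO.of_bound C (.of_forall fun w => ?_)
    simpa using hb w
  · have := (Asymptotics.isLittleO_pow_pow (𝕜 := ℝ) (one_lt_two)).comp_tendsto
      (tendsto_norm_zero (E := E))
    refine Asymptotics.IsLittleO.of_norm_right ?_
    simpa [Function.comp_def] using this

lemma continuous_gradient_of_lipschitz {h : E → ℝ} {L : ℝ}
    (hL : ∀ y z, ‖gradient h y - gradient h z‖ ≤ L * ‖y - z‖) : Continuous (gradient h) := by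
  have hl : LipschitzWith (Real.toNNReal L) (gradient h) :=
    LipschitzWith.of_dist_le_mul fun y z => by
      rw [dist_eq_norm, dist_eq_norm]
      exact (hL y z).trans (by gcongr; exact Real.le_coe_toNNReal L)
  exact hl.continuous

/-- A gradient step of length `s` lowers `h` by at least `(s - L s²/2)‖∇h‖²`, yet cannot go below
the infimum; `s = 1/L` is the best choice. -/
lemma norm_gradient_sq_le {h : E → ℝ} (hd : Differentiable ℝ h) {L : ℝ} (hL0 : 0 ≤ L)
    (hL : ∀ y z, ‖gradient h y - gradient h z‖ ≤ L * ‖y - z‖)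
    (hb : BddBelow (Set.range h)) (y : E) :
    ‖gradient h y‖ ^ 2 ≤ 2 * L * (h y - ⨅ z, h z) := by
  set G := ‖gradient h y‖ ^ 2 with hG
  have key : ∀ s : ℝ, s * G - L / 2 * s ^ 2 * G ≤ h y - ⨅ z, h z := by
    intro s
    have h1 := (abs_le.1 (abs_sub_sub_inner_gradient_le hd hL y (-(s • gradient h y)))).2
    have h2 := ciInf_le hb (y + -(s • gradient h y))
    rw [inner_neg_right, inner_smul_right, real_inner_self_eq_norm_sq, norm_neg, norm_smul,
      mul_pow, Real.norm_eq_abs, sq_abs, ← hG] at h1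
    linarith
  rcases hL0.eq_or_lt with rfl | hLpos
  · by_contra hne
    have hGpos : 0 < G := by
      rw [mul_zero, zero_mul, not_le] at hne
      exact hne
    -- For `L = 0` the guaranteed decrease is `s G`; this `s` makes it exceed the available gap by
    -- 1.
    have h1 := key ((h y - (⨅ z, h z) + 1) / G)
    rw [div_mul_cancel₀ _ hGpos.ne'] at h1
    linarith
  · have h1 := key (1 / L)
    have h2 : 1 / L * G - L / 2 * (1 / L) ^ 2 * G = G / (2 * L) := by
      field_simp
      ring
    rw [h2, div_le_iff₀ (by positivity)] at h1
    linarith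

lemma contDiff_one_of_lipschitz_gradient {h : E → ℝ} (hd : Differentiable ℝ h) {L : ℝ}
    (hL : ∀ y z, ‖gradient h y - gradient h z‖ ≤ L * ‖y - z‖) : ContDiff ℝ 1 h := by
  rw [contDiff_one_iff_fderiv]
  refine ⟨hd, ?_⟩
  have : fderiv ℝ h = fun y => InnerProductSpace.toDual ℝ E (gradient h y) := by
    ext1 y
    exact (hd y).hasGradientAt.hasFDerivAt.fderiv
  rw [this]
  exact (InnerProductSpace.toDual ℝ E).continuous.comp (continuous_gradient_of_lipschitz hL)

end Smooth

/-! ### The gradient of the spherical smoothing. -/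

section Smoothing

variable {d : ℕ}

/-- The gradient of the smoothed function is the averaged gradient. -/
lemma hasGradientAt_smoothing {f : EuclideanSpace ℝ (Fin d) → ℝ} (hd : Differentiable ℝ f) {L : ℝ}
    (hL : ∀ y z, ‖gradient f y - gradient f z‖ ≤ L * ‖y - z‖) (μ : ℝ)
    (x : EuclideanSpace ℝ (Fin d)) :
    HasGradientAt (smoothing μ f)
      (⨍ v in Metric.closedBall (0 : EuclideanSpace ℝ (Fin d)) 1, gradient f (x + μ • v)) x := by
  set B := Metric.closedBall (0 : EuclideanSpace ℝ (Fin d)) 1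
  have hB0 : volume B ≠ 0 := (Metric.measure_closedBall_pos _ _ one_pos).ne'
  have hBt : volume B ≠ ⊤ := measure_closedBall_lt_top.ne
  have : IsProbabilityMeasure ((volume : Measure (EuclideanSpace ℝ (Fin d)))[|B]) :=
    cond_isProbabilityMeasure_of_finite hB0 hBt
  have hint : ∀ {G : Type} [NormedAddCommGroup G] [NormedSpace ℝ G]
      {g : EuclideanSpace ℝ (Fin d) → G}, Continuous g →
      Integrable g (volume[|B]) := by
    intro G _ _ g hg
    exact (hg.continuousOn.integrableOn_compact (isCompact_closedBall _ _)).smul_measure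
      (ENNReal.inv_ne_top.2 hB0)
  have havg : ∀ {G : Type} [NormedAddCommGroup G] [NormedSpace ℝ G]
      (g : EuclideanSpace ℝ (Fin d) → G),
      ⨍ v in B, g v = ∫ v, g v ∂(volume[|B]) := by
    intro G _ _ g
    rw [average_eq', ProbabilityTheory.cond, Measure.restrict_apply_univ]
  have hfc := hd.continuous
  have hgc := continuous_gradient_of_lipschitz hL
  refine hasGradientAt_of_quadratic_bound (C := L / 2) fun w => ?_
  simp only [smoothing]
  rw [havg, havg, havg, real_inner_comm, ← integral_inner (hint (by fun_prop)),
    ← integral_sub (hint (by fun_prop)) (hint (by fun_prop)),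
    ← integral_sub (hint (by fun_prop)) (hint (by fun_prop)), ← Real.norm_eq_abs]
  refine (norm_integral_le_of_norm_le_const (C := L / 2 * ‖w‖ ^ 2) (.of_forall fun v => ?_)).trans
    (by simp)
  rw [Real.norm_eq_abs, real_inner_comm, show x + w + μ • v = x + μ • v + w by abel]
  exact abs_sub_sub_inner_gradient_le hd hL _ _

/-- The two-point representation of the gradient of the smoothed function. -/
lemma inner_gradient_smoothing (hd1 : 1 ≤ d) {f : EuclideanSpace ℝ (Fin d) → ℝ}
    (hd : Differentiable ℝ f) {L : ℝ}
    (hL : ∀ y z, ‖gradient f y - gradient f z‖ ≤ L * ‖y - z‖) {μ : ℝ} (hμ : 0 < μ)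
    (x e : EuclideanSpace ℝ (Fin d)) :
    inner ℝ (gradient (smoothing μ f) x) e =
      d * ∫ u : Metric.sphere (0 : EuclideanSpace ℝ (Fin d)) 1,
        (f (x + μ • (u : EuclideanSpace ℝ (Fin d))) - f (x - μ • (u : EuclideanSpace ℝ (Fin d)))) /
          (2 * μ) * inner ℝ (u : EuclideanSpace ℝ (Fin d)) e ∂(unifSphere d) := by
  have : Nonempty (Fin d) := ⟨⟨0, hd1⟩⟩
  have hfC := contDiff_one_of_lipschitz_gradient hd hL
  have hgc := continuous_gradient_of_lipschitz hL
  set φ : EuclideanSpace ℝ (Fin d) → ℝ := fun v => (f (x + μ • v) - f (x - μ • v)) / (2 * μ) with hφ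
  have hφC : ContDiff ℝ 1 φ :=
    ((hfC.comp (contDiff_const.add (contDiff_id.const_smul μ))).sub
      (hfC.comp (contDiff_const.sub (contDiff_id.const_smul μ)))).div_const _
  have hφd : ∀ v, fderiv ℝ φ v e =
      (inner ℝ (gradient f (x + μ • v)) e + inner ℝ (gradient f (x - μ • v)) e) / 2 := by
    intro v
    have a1 : HasFDerivAt (fun v : EuclideanSpace ℝ (Fin d) => x + μ • v)
        (μ • ContinuousLinearMap.id ℝ (EuclideanSpace ℝ (Fin d))) v :=
      ((hasFDerivAt_id v).const_smul μ).const_add x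
    have a2 : HasFDerivAt (fun v : EuclideanSpace ℝ (Fin d) => x - μ • v)
        (-(μ • ContinuousLinearMap.id ℝ (EuclideanSpace ℝ (Fin d)))) v :=
      ((hasFDerivAt_id v).const_smul μ).const_sub x
    have b1 := ((hd (x + μ • v)).hasGradientAt.hasFDerivAt).comp v a1
    have b2 := ((hd (x - μ • v)).hasGradientAt.hasFDerivAt).comp v a2
    have b3 : HasFDerivAt φ _ v := ((b1.sub b2).mul_const (2 * μ)⁻¹)
    rw [b3.fderiv]
    simp
    field_simp
  have hdiv := integral_closedBall_fderiv (volume : Measure (EuclideanSpace ℝ (Fin d))) hφC e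
  set B := Metric.closedBall (0 : EuclideanSpace ℝ (Fin d)) 1 with hB
  have hint : ∀ {g : EuclideanSpace ℝ (Fin d) → ℝ}, Continuous g → IntegrableOn g B volume :=
    fun hg => hg.continuousOn.integrableOn_compact (isCompact_closedBall _ _)
  -- The ball is symmetric under `v ↦ -v`, so both halves of the symmetrised difference contribute
  -- equally.
  have hneg : ∫ v in B, inner ℝ (gradient f (x - μ • v)) e =
      ∫ v in B, inner ℝ (gradient f (x + μ • v)) e := by
    have := (Measure.measurePreserving_neg
      (volume : Measure (EuclideanSpace ℝ (Fin d)))).setIntegral_preimage_emb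
      (MeasurableEquiv.neg (EuclideanSpace ℝ (Fin d))).measurableEmbedding
      (fun v => inner ℝ (gradient f (x + μ • v)) e) B
    rw [← this]
    have hpre : (Neg.neg : EuclideanSpace ℝ (Fin d) → EuclideanSpace ℝ (Fin d)) ⁻¹' B = B := by
      ext v
      simp [hB]
    rw [hpre]
    simp [sub_eq_add_neg]
  have hlhs : ∫ v in B, fderiv ℝ φ v e = ∫ v in B, inner ℝ (gradient f (x + μ • v)) e := by
    simp only [hφd]
    rw [integral_div, integral_add (hint (by fun_prop)) (hint (by fun_prop)), hneg]
    ring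
  have hgint : IntegrableOn (fun v => gradient f (x + μ • v)) B volume :=
    (by fun_prop : Continuous fun v => gradient f (x + μ • v)).continuousOn.integrableOn_compact
      (isCompact_closedBall _ _)
  have hd0 : (d : ℝ) ≠ 0 := by positivity
  -- The factor `d` in the formula is the ratio of the total surface mass to the volume of the ball.
  have hvol : (volume : Measure (EuclideanSpace ℝ (Fin d))).real (Metric.ball 0 1) =
      (volume : Measure (EuclideanSpace ℝ (Fin d))).real B := by
    rw [Measure.real, Measure.real, hB, Measure.addHaar_closedBall_eq_addHaar_ball]
  rw [(hasGradientAt_smoothing hd hL μ x).gradient, setAverage_eq, inner_smul_left,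
    real_inner_comm, ← integral_inner hgint, unifSphere, integral_smul_measure, ENNReal.toReal_inv,
    ← Measure.real, Measure.toSphere_real_apply_univ, hvol, ← hdiv, hlhs]
  simp only [real_inner_comm, conj_trivial, smul_eq_mul, finrank_euclideanSpace, Fintype.card_fin,
    ← hB]
  field_simp

end Smoothing

/-! ### Measurability, integrability and averaging of sample gradients. -/

section Objective

variable {d : ℕ} {Ξ : Type*} [MeasurableSpace Ξ] {P : Measure Ξ}
  {F : EuclideanSpace ℝ (Fin d) → Ξ → ℝ}

/-- A directional derivative is the pointwise limit of difference quotients with steps `1/n`, each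
measurable in `ξ`. -/
lemma measurable_inner_gradient (hFdiff : ∀ ξ, Differentiable ℝ (fun y => F y ξ))
    (hFmeas : ∀ y, Measurable (F y)) (y w : EuclideanSpace ℝ (Fin d)) :
    Measurable fun ξ => inner ℝ (gradient (fun z => F z ξ) y) w := by
  refine measurable_of_tendsto_metrizable (f := fun (n : ℕ) ξ =>
    (n : ℝ) * (F (y + (n : ℝ)⁻¹ • w) ξ - F y ξ))
    (fun n => ((hFmeas _).sub (hFmeas _)).const_mul _) ?_
  rw [tendsto_pi_nhds]
  intro ξ
  have h := ((hFdiff ξ y).hasGradientAt.hasFDerivAt).lim w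
    (c := fun n : ℕ => (n : ℝ)) (l := Filter.atTop) ?_
  · simpa using h
  · simpa using tendsto_natCast_atTop_atTop (R := ℝ)

lemma sum_inner_single_smul (a : EuclideanSpace ℝ (Fin d)) :
    ∑ i : Fin d, inner ℝ a (EuclideanSpace.single i (1 : ℝ)) • EuclideanSpace.single i (1 : ℝ) =
      a := by
  have := (EuclideanSpace.basisFun (Fin d) ℝ).sum_repr' a
  simpa [real_inner_comm] using this

lemma measurable_gradient (hFdiff : ∀ ξ, Differentiable ℝ (fun y => F y ξ))
    (hFmeas : ∀ y, Measurable (F y)) (y : EuclideanSpace ℝ (Fin d)) :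
    Measurable fun ξ => gradient (fun z => F z ξ) y := by
  have : (fun ξ => gradient (fun z => F z ξ) y) = fun ξ => ∑ i : Fin d,
      inner ℝ (gradient (fun z => F z ξ) y) (EuclideanSpace.single i (1 : ℝ)) •
        EuclideanSpace.single i (1 : ℝ) := funext fun ξ => (sum_inner_single_smul _).symm
  rw [this]
  exact Finset.measurable_sum _ fun i _ =>
    (measurable_inner_gradient hFdiff hFmeas y _).smul_const _

variable [IsProbabilityMeasure P]

/-- The Taylor bound dominates each directional derivative by two values of `F` and a constant, so
integrability of `F` is enough; the vector is then rebuilt from its coordinates. -/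
lemma integrable_gradient (hFdiff : ∀ ξ, Differentiable ℝ (fun y => F y ξ))
    (hFmeas : ∀ y, Measurable (F y)) (hFint : ∀ y, Integrable (F y) P) {L : ℝ}
    (hsmooth : ∀ᵐ ξ ∂P, ∀ y z,
      ‖gradient (fun w => F w ξ) y - gradient (fun w => F w ξ) z‖ ≤ L * ‖y - z‖)
    (y : EuclideanSpace ℝ (Fin d)) :
    Integrable (fun ξ => gradient (fun z => F z ξ) y) P := by
  have hin : ∀ w, Integrable (fun ξ => inner ℝ (gradient (fun z => F z ξ) y) w) P := by
    intro w
    refine Integrable.mono' (g := fun ξ => |F (y + w) ξ| + |F y ξ| + L / 2 * ‖w‖ ^ 2)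
      (((hFint _).abs.add (hFint _).abs).add (integrable_const _))
      (measurable_inner_gradient hFdiff hFmeas y w).aestronglyMeasurable ?_
    filter_upwards [hsmooth] with ξ hξ
    have := abs_sub_sub_inner_gradient_le (hFdiff ξ) hξ y w
    rw [Real.norm_eq_abs]
    have h1 := abs_le.1 this
    have h2 := abs_le.1 (le_refl |F (y + w) ξ|)
    have h3 := abs_le.1 (le_refl |F y ξ|)
    rw [abs_le]
    constructor <;> linarith
  have : (fun ξ => gradient (fun z => F z ξ) y) = fun ξ => ∑ i : Fin d,
      inner ℝ (gradient (fun z => F z ξ) y) (EuclideanSpace.single i (1 : ℝ)) •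
        EuclideanSpace.single i (1 : ℝ) := funext fun ξ => (sum_inner_single_smul _).symm
  rw [this]
  exact integrable_finsetSum _ fun i _ => (hin _).smul_const _

lemma hasGradientAt_objective (hFdiff : ∀ ξ, Differentiable ℝ (fun y => F y ξ))
    (hFmeas : ∀ y, Measurable (F y)) (hFint : ∀ y, Integrable (F y) P) {L : ℝ}
    (hsmooth : ∀ᵐ ξ ∂P, ∀ y z,
      ‖gradient (fun w => F w ξ) y - gradient (fun w => F w ξ) z‖ ≤ L * ‖y - z‖)
    (y : EuclideanSpace ℝ (Fin d)) :
    HasGradientAt (objective P F) (∫ ξ, gradient (fun z => F z ξ) y ∂P) y := by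
  have hGi := integrable_gradient hFdiff hFmeas hFint hsmooth y
  refine hasGradientAt_of_quadratic_bound (C := L / 2) fun w => ?_
  simp only [objective]
  rw [real_inner_comm, ← integral_inner hGi, ← integral_sub (hFint _) (hFint _),
    ← integral_sub (by exact (hFint _).sub (hFint _)) (hGi.const_inner w), ← Real.norm_eq_abs]
  refine (norm_integral_le_of_norm_le_const (C := L / 2 * ‖w‖ ^ 2) ?_).trans (by simp)
  filter_upwards [hsmooth] with ξ hξ
  rw [Real.norm_eq_abs, real_inner_comm]
  exact abs_sub_sub_inner_gradient_le (hFdiff ξ) hξ y w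

lemma norm_gradient_objective_sub_le (hFdiff : ∀ ξ, Differentiable ℝ (fun y => F y ξ))
    (hFmeas : ∀ y, Measurable (F y)) (hFint : ∀ y, Integrable (F y) P) {L : ℝ}
    (hsmooth : ∀ᵐ ξ ∂P, ∀ y z,
      ‖gradient (fun w => F w ξ) y - gradient (fun w => F w ξ) z‖ ≤ L * ‖y - z‖)
    (y z : EuclideanSpace ℝ (Fin d)) :
    ‖gradient (objective P F) y - gradient (objective P F) z‖ ≤ L * ‖y - z‖ := by
  rw [(hasGradientAt_objective hFdiff hFmeas hFint hsmooth y).gradient,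
    (hasGradientAt_objective hFdiff hFmeas hFint hsmooth z).gradient,
    ← integral_sub (integrable_gradient hFdiff hFmeas hFint hsmooth y)
      (integrable_gradient hFdiff hFmeas hFint hsmooth z)]
  refine (norm_integral_le_of_norm_le_const (C := L * ‖y - z‖) ?_).trans (by simp)
  filter_upwards [hsmooth] with ξ hξ using hξ y z

end Objective

/-! ### Truncated moments under a weak-`L_p` tail. -/

section Tail

variable {Ω : Type*} [MeasurableSpace Ω] {m : Measure Ω} [IsProbabilityMeasure m]

/-- Layer cake: levels up to `s²` contribute at most `s²`, and for `t` between `s²` and `c²` the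
tail `(s/√t)^p` is at most `s^p c^(2-p) / t`. Integrating `1/t` yields the logarithm; unlike exact
integration of the power, this involves no factor `1/(2-p)`. -/
lemma integral_min_sq_le {Z : Ω → ℝ} (hZm : Measurable Z) (hZ0 : ∀ ω, 0 ≤ Z ω) {s c p : ℝ}
    (hs : 0 < s) (hsc : s ≤ c) (hp2 : p ≤ 2)
    (htail : ∀ t, 0 < t → m.real {ω | t < Z ω} ≤ (s / t) ^ p) :
    ∫ ω, (min (Z ω) c) ^ 2 ∂m ≤ s ^ 2 + 2 * (s ^ p * c ^ (2 - p) * Real.log (c / s)) := by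
  have hc : 0 < c := hs.trans_le hsc
  have hsc2 : s ^ 2 ≤ c ^ 2 := pow_le_pow_left₀ hs.le hsc 2
  have hs2 : 0 < s ^ 2 := by positivity
  set K := s ^ p * c ^ (2 - p) with hK
  have hint : Integrable (fun ω => (min (Z ω) c) ^ 2) m := by
    refine Integrable.of_bound (by fun_prop) (c ^ 2) (.of_forall fun ω => ?_)
    have h0 : 0 ≤ min (Z ω) c := le_min (hZ0 ω) hc.le
    rw [Real.norm_eq_abs, abs_of_nonneg (by positivity)]
    exact pow_le_pow_left₀ h0 (min_le_right _ _) 2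
  rw [hint.integral_eq_integral_meas_lt (.of_forall fun ω => sq_nonneg _)]
  set g : ℝ → ℝ := fun t => (Set.Ioc 0 (s ^ 2)).indicator (fun _ => (1 : ℝ)) t +
    (Set.Ioc (s ^ 2) (c ^ 2)).indicator (fun t => K * t⁻¹) t with hg
  have hg1 : IntegrableOn (fun _ : ℝ => (1 : ℝ)) (Set.Ioc 0 (s ^ 2)) := by simp
  have hg2i : IntervalIntegrable (fun t : ℝ => K * t⁻¹) volume (s ^ 2) (c ^ 2) := by
    refine ContinuousOn.intervalIntegrable ?_
    refine continuousOn_const.mul (continuousOn_id.inv₀ fun t ht => ?_)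
    rw [Set.uIcc_of_le hsc2] at ht
    exact (hs2.trans_le ht.1).ne'
  have hg2 : IntegrableOn (fun t : ℝ => K * t⁻¹) (Set.Ioc (s ^ 2) (c ^ 2)) := hg2i.1
  have hg1' := (hg1.integrable_indicator measurableSet_Ioc).restrict (s := Set.Ioi 0)
  have hg2' := (hg2.integrable_indicator measurableSet_Ioc).restrict (s := Set.Ioi 0)
  have hle : ∀ t ∈ Set.Ioi (0 : ℝ), m.real {ω | t < (min (Z ω) c) ^ 2} ≤ g t := by
    intro t ht
    have ht0 : (0 : ℝ) < t := ht
    rcases le_or_gt t (s ^ 2) with h1 | h1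
    · have : g t = 1 := by
        simp [hg, Set.indicator, ht0, h1]
      rw [this]
      exact measureReal_le_one
    · rcases le_or_gt t (c ^ 2) with h2 | h2
      · have : g t = K * t⁻¹ := by
          simp [hg, Set.indicator, h1, h2]
        rw [this]
        have hsub : {ω | t < (min (Z ω) c) ^ 2} ⊆ {ω | √t < Z ω} := by
          intro ω (hω : t < _)
          have h0 : 0 ≤ min (Z ω) c := le_min (hZ0 ω) hc.le
          exact ((Real.sqrt_lt_sqrt ht0.le hω).trans_eq (Real.sqrt_sq h0)).trans_le
            (min_le_left _ _)
        refine (measureReal_mono hsub).trans ((htail _ (Real.sqrt_pos.2 ht0)).trans ?_)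
        rw [Real.div_rpow hs.le (Real.sqrt_nonneg _), hK, mul_assoc, div_eq_mul_inv]
        refine mul_le_mul_of_nonneg_left ?_ (by positivity)
        rw [inv_le_comm₀ (by positivity) (by positivity), mul_inv, inv_inv]
        have h3 : t = √t ^ (2 - p) * √t ^ p := by
          rw [← Real.rpow_add (Real.sqrt_pos.2 ht0), sub_add_cancel, Real.rpow_two,
            Real.sq_sqrt ht0.le]
        have h4 : √t ^ (2 - p) ≤ c ^ (2 - p) :=
          Real.rpow_le_rpow (Real.sqrt_nonneg _) (Real.sqrt_le_iff.2 ⟨hc.le, h2⟩) (by linarith)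
        rw [inv_mul_le_iff₀ (by positivity)]
        calc t = √t ^ (2 - p) * √t ^ p := h3
          _ ≤ _ := by gcongr
      · have : {ω | t < (min (Z ω) c) ^ 2} = ∅ := by
          ext ω
          have h0 : 0 ≤ min (Z ω) c := le_min (hZ0 ω) hc.le
          simpa using (pow_le_pow_left₀ h0 (min_le_right (Z ω) c) 2).trans h2.le
        rw [this, measureReal_empty]
        simp [hg, Set.indicator, h1.not_ge, h2.not_ge]
  calc ∫ t in Set.Ioi 0, m.real {ω | t < (min (Z ω) c) ^ 2}
      ≤ ∫ t in Set.Ioi 0, g t :=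
        integral_mono_of_nonneg (.of_forall fun t => measureReal_nonneg) (hg1'.add hg2')
          ((ae_restrict_iff' measurableSet_Ioi).2 (.of_forall hle))
    _ = s ^ 2 + K * ∫ t in (s ^ 2)..(c ^ 2), t⁻¹ := by
        rw [hg, integral_add hg1' hg2', setIntegral_indicator measurableSet_Ioc,
          setIntegral_indicator measurableSet_Ioc, Set.inter_eq_self_of_subset_right
            (Set.Ioc_subset_Ioi_self), Set.inter_eq_self_of_subset_right
            (Set.Ioc_subset_Ioi_self.trans (Set.Ioi_subset_Ioi hs2.le)),
          intervalIntegral.integral_of_le hsc2, integral_const_mul]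
        simp [hs2.le]
    _ = _ := by
        rw [integral_inv_of_pos hs2 (by positivity), ← div_pow, Real.log_pow]
        push_cast
        ring

/-- In the layer cake for `max Z c` the levels below `c` contribute at most `c`, which the
subtraction absorbs. The remaining integral of `(s/t)^p` over `t > c` converges because `p > 1` and
gives the factor `1/(p-1)`. -/
lemma integral_max_sub_le {Z : Ω → ℝ} (hZi : Integrable Z m) (hZ0 : ∀ ω, 0 ≤ Z ω) {s c p : ℝ}
    (hs : 0 < s) (hc : 0 < c) (hp1 : 1 < p)
    (htail : ∀ t, 0 < t → m.real {ω | t < Z ω} ≤ (s / t) ^ p) :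
    ∫ ω, (max (Z ω) c - c) ∂m ≤ s ^ p * (c ^ (1 - p) / (p - 1)) := by
  have hint : Integrable (fun ω => max (Z ω) c) m := hZi.sup (integrable_const c)
  rw [integral_sub hint (integrable_const c)]
  rw [hint.integral_eq_integral_meas_lt (.of_forall fun ω => (hZ0 ω).trans (le_max_left _ _))]
  set g : ℝ → ℝ := fun t => (Set.Ioc 0 c).indicator (fun _ => (1 : ℝ)) t +
    (Set.Ioi c).indicator (fun t => s ^ p * t ^ (-p)) t with hg
  have hg1 : IntegrableOn (fun _ : ℝ => (1 : ℝ)) (Set.Ioc 0 c) := by simp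
  have hg2 : IntegrableOn (fun t : ℝ => s ^ p * t ^ (-p)) (Set.Ioi c) :=
    (integrableOn_Ioi_rpow_of_lt (by linarith) hc).const_mul _
  have hg1' := (hg1.integrable_indicator measurableSet_Ioc).restrict (s := Set.Ioi 0)
  have hg2' := (hg2.integrable_indicator measurableSet_Ioi).restrict (s := Set.Ioi 0)
  have hle : ∀ t ∈ Set.Ioi (0 : ℝ), m.real {ω | t < max (Z ω) c} ≤ g t := by
    intro t ht
    have ht0 : (0 : ℝ) < t := ht
    rcases le_or_gt t c with h1 | h1
    · have : g t = 1 := by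
        simp [hg, Set.indicator, ht0, h1]
      rw [this]
      exact measureReal_le_one
    · have : g t = (s / t) ^ p := by
        simp [hg, Set.indicator, h1, h1.not_ge, Real.div_rpow hs.le ht0.le, Real.rpow_neg ht0.le,
          ← div_eq_mul_inv]
      rw [this]
      refine (measureReal_mono fun ω (hω : t < _) => ?_).trans (htail t ht0)
      rcases lt_max_iff.1 hω with h | h
      · exact h
      · exact absurd h h1.not_gt
  have h1 : ∫ t in Set.Ioi 0, m.real {ω | t < max (Z ω) c} ≤ ∫ t in Set.Ioi 0, g t :=
    integral_mono_of_nonneg (.of_forall fun t => measureReal_nonneg) (hg1'.add hg2')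
      ((ae_restrict_iff' measurableSet_Ioi).2 (.of_forall hle))
  have h2 : ∫ t in Set.Ioi 0, g t = c + s ^ p * (c ^ (1 - p) / (p - 1)) := by
    rw [hg, integral_add hg1' hg2', setIntegral_indicator measurableSet_Ioc,
      setIntegral_indicator measurableSet_Ioi, Set.inter_eq_self_of_subset_right
        (Set.Ioc_subset_Ioi_self), Set.inter_eq_self_of_subset_right
        (Set.Ioi_subset_Ioi hc.le), integral_const_mul,
      integral_Ioi_rpow_of_lt (by linarith) hc]
    have : -p + 1 = -(p - 1) := by ring
    rw [this, neg_div_neg_eq, neg_sub]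
    simp [hc.le]
  have h3 : ∫ _, c ∂m = c := by simp
  linarith

end Tail

/-! ### Weak-`L_p` tail of the noise projected on a random direction. -/

section SphereTail

variable {d : ℕ} {Ξ : Type*} [MeasurableSpace Ξ] {P : Measure Ξ} [IsProbabilityMeasure P]

/-- Projection on a uniform random direction divides the scale of a weak-`L_p` vector by `√d`. -/
lemma prod_real_abs_inner_gt_le (hd : 1 ≤ d) {N : Ξ → EuclideanSpace ℝ (Fin d)}
    (hN : Measurable N) {p σ : ℝ} (hp0 : 0 < p) (hp2 : p ≤ 2) (hσ : 0 < σ)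
    (htail : ∀ t, 0 < t → P.real {ξ | t < ‖N ξ‖} ≤ (σ / t) ^ p) {t : ℝ} (ht : 0 < t) :
    ((unifSphere d).prod P).real
      {q | t < |inner ℝ (N q.2) (q.1 : EuclideanSpace ℝ (Fin d))|} ≤ (σ / √(d : ℝ) / t) ^ p := by
  have := isProbabilityMeasure_unifSphere hd
  set e : EuclideanSpace ℝ (Fin d) := EuclideanSpace.single ⟨0, hd⟩ 1 with he
  have hen : ‖e‖ = 1 := by simp [he]
  have hm1 : MeasurableSet {q : Metric.sphere (0 : EuclideanSpace ℝ (Fin d)) 1 × Ξ |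
      t < |inner ℝ (N q.2) (q.1 : EuclideanSpace ℝ (Fin d))|} :=
    measurableSet_lt measurable_const (by fun_prop)
  have hm2 : MeasurableSet {q : Metric.sphere (0 : EuclideanSpace ℝ (Fin d)) 1 × Ξ |
      t < |inner ℝ (‖N q.2‖ • e) (q.1 : EuclideanSpace ℝ (Fin d))|} :=
    measurableSet_lt measurable_const (by fun_prop)
  have hint : Integrable (fun u : Metric.sphere (0 : EuclideanSpace ℝ (Fin d)) 1 =>
      (σ / t) ^ p * |inner ℝ e (u : EuclideanSpace ℝ (Fin d))| ^ p) (unifSphere d) := by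
    refine (Integrable.of_bound (C := 1) (Measurable.aestronglyMeasurable (by fun_prop))
      (.of_forall fun u => ?_)).const_mul _
    rw [Real.norm_eq_abs, abs_of_nonneg (by positivity)]
    exact Real.rpow_le_one (abs_nonneg _) ((norm_inner_sphere_le e u).trans_eq hen) hp0.le
  have hchain : ((unifSphere d).prod P)
      {q | t < |inner ℝ (N q.2) (q.1 : EuclideanSpace ℝ (Fin d))|} ≤
        ENNReal.ofReal ((σ / √(d : ℝ) / t) ^ p) := by
    calc _ = ∫⁻ ξ, unifSphere d {u | t < |inner ℝ (N ξ) (u : EuclideanSpace ℝ (Fin d))|} ∂P := by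
          rw [Measure.prod_apply_symm hm1]
          rfl
      -- For fixed `ξ`, isotropy allows `N ξ` to be turned onto the fixed axis `e`. The order of
      -- integration can then be swapped, and for fixed `u` the tail of `‖N‖` applies at level `t /
      -- |⟪e, u⟫|`.
      _ = ∫⁻ ξ, unifSphere d {u | t < |inner ℝ (‖N ξ‖ • e) (u : EuclideanSpace ℝ (Fin d))|} ∂P := by
          refine lintegral_congr fun ξ => ?_
          have hmap := map_inner_unifSphere (a := N ξ) (b := ‖N ξ‖ • e) (by simp [norm_smul, hen])
          have hs : MeasurableSet {z : ℝ | t < |z|} :=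
            measurableSet_lt measurable_const (by fun_prop)
          have := congrArg (fun ν => ν {z : ℝ | t < |z|}) hmap
          rwa [Measure.map_apply (by fun_prop) hs, Measure.map_apply (by fun_prop) hs] at this
      _ = ((unifSphere d).prod P)
            {q | t < |inner ℝ (‖N q.2‖ • e) (q.1 : EuclideanSpace ℝ (Fin d))|} := by
          rw [Measure.prod_apply_symm hm2]
          rfl
      _ = ∫⁻ u, P {ξ | t < |inner ℝ (‖N ξ‖ • e) (u : EuclideanSpace ℝ (Fin d))|}
            ∂(unifSphere d) := by
          rw [Measure.prod_apply hm2]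
          rfl
      _ ≤ ∫⁻ u : Metric.sphere (0 : EuclideanSpace ℝ (Fin d)) 1, ENNReal.ofReal ((σ / t) ^ p *
            |inner ℝ e (u : EuclideanSpace ℝ (Fin d))| ^ p) ∂(unifSphere d) := by
          refine lintegral_mono fun u => ?_
          rw [← ofReal_measureReal]
          refine ENNReal.ofReal_le_ofReal ?_
          set a := |inner ℝ e (u : EuclideanSpace ℝ (Fin d))| with ha
          have hset : {ξ | t < |inner ℝ (‖N ξ‖ • e) (u : EuclideanSpace ℝ (Fin d))|} =
              {ξ | t < ‖N ξ‖ * a} := by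
            ext ξ
            simp [inner_smul_left, abs_mul, ha]
          rw [hset]
          have ha0 : 0 ≤ a := abs_nonneg _
          clear_value a
          rcases ha0.eq_or_lt with h0 | h0
          · have : {ξ | t < ‖N ξ‖ * a} = ∅ := by
              ext ξ
              simp [← h0, ht.le]
            rw [this, measureReal_empty]
            positivity
          · have : {ξ | t < ‖N ξ‖ * a} = {ξ | t / a < ‖N ξ‖} := by
              ext ξ
              simp [div_lt_iff₀ h0]
            rw [this]
            refine (htail (t / a) (by positivity)).trans_eq ?_
            rw [← Real.mul_rpow (by positivity) h0.le]
            congr 1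
            field_simp
      _ = ENNReal.ofReal (∫ u : Metric.sphere (0 : EuclideanSpace ℝ (Fin d)) 1, (σ / t) ^ p *
            |inner ℝ e (u : EuclideanSpace ℝ (Fin d))| ^ p ∂(unifSphere d)) :=
          (ofReal_integral_eq_lintegral_ofReal hint (.of_forall fun u => by positivity)).symm
      _ ≤ _ := by
          refine ENNReal.ofReal_le_ofReal ?_
          rw [integral_const_mul]
          calc _ ≤ (σ / t) ^ p * (1 / √(d : ℝ)) ^ p := by
                gcongr
                exact integral_abs_inner_rpow_unifSphere_le hd hp0 hp2 hen
            _ = _ := by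
                rw [← Real.mul_rpow (by positivity) (by positivity)]
                congr 1
                field_simp
  exact ENNReal.toReal_le_of_le_ofReal (by positivity) hchain

end SphereTail

/-! ### Scalar clipping of a sum of two contributions. -/

section Clip

lemma abs_clip {τ : ℝ} (hτ : 0 ≤ τ) (z : ℝ) : |clip τ z| = min |z| τ := by
  rcases eq_or_ne z 0 with rfl | hz
  · simp [clip, hτ]
  · have hz' : 0 < |z| := abs_pos.2 hz
    rw [clip, abs_mul, abs_of_nonneg (a := min 1 (τ / |z|)) (by positivity),
      mul_min_of_nonneg _ _ hz'.le]
    congr 1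
    · ring
    · field_simp

lemma abs_sub_clip {τ : ℝ} (hτ : 0 ≤ τ) (z : ℝ) : |z - clip τ z| = max |z| τ - τ := by
  rcases eq_or_ne z 0 with rfl | hz
  · simp [clip, hτ]
  · have hz' : 0 < |z| := abs_pos.2 hz
    have : z - clip τ z = z * (1 - min 1 (τ / |z|)) := by rw [clip]; ring
    rw [this, abs_mul, abs_of_nonneg (a := 1 - _) (by simp)]
    rcases le_total |z| τ with h | h
    · rw [max_eq_right h, min_eq_left ((one_le_div hz').2 h)]
      ring
    · rw [max_eq_left h, min_eq_right ((div_le_one hz').2 h)]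
      field_simp

lemma measurable_clip (τ : ℝ) : Measurable (clip τ) := by
  unfold clip
  fun_prop

/-- Half of the threshold is charged to each summand, and `a - τ/2 ≤ a²/(2τ)` is `(a - τ)² ≥ 0`. The
signal thus enters the bias only through its second moment. -/
lemma max_sub_le_of_le_add {z a b τ : ℝ} (hτ : 0 < τ) (hz : z ≤ a + b) :
    max z τ - τ ≤ a ^ 2 / (2 * τ) + (max b (τ / 2) - τ / 2) := by
  have h1 : a - τ / 2 ≤ a ^ 2 / (2 * τ) := by
    rw [le_div_iff₀ (by positivity)]
    nlinarith [sq_nonneg (a - τ)]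
  have h2 : b ≤ max b (τ / 2) := le_max_left _ _
  have h3 : τ / 2 ≤ max b (τ / 2) := le_max_right _ _
  have h4 : 0 ≤ a ^ 2 / (2 * τ) := by positivity
  rcases max_cases z τ with ⟨h, _⟩ | ⟨h, _⟩ <;> rw [h] <;> linarith

lemma min_sq_le_of_le_add {z a b τ : ℝ} (hτ : 0 < τ) (hz0 : 0 ≤ z) (ha : 0 ≤ a)
    (hz : z ≤ a + b) : (min z τ) ^ 2 ≤ 2 * a ^ 2 + 2 * (min b τ) ^ 2 := by
  have h1 : min z τ ≤ a + min b τ := by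
    rcases min_cases b τ with ⟨h, _⟩ | ⟨h, _⟩ <;> rw [h]
    · exact (min_le_left _ _).trans hz
    · exact (min_le_right _ _).trans (by linarith)
  have h0 : 0 ≤ min z τ := le_min hz0 hτ.le
  nlinarith [sq_nonneg (a - min b τ), pow_le_pow_left₀ h0 h1 2]

end Clip

/-! ### Clipping bias and second moment from the signal-noise split. -/

section Decomposition

variable {α : Type*} [MeasurableSpace α] {m : Measure α} [IsProbabilityMeasure m]
  {Y A B : α → ℝ} {S τ p : ℝ}

lemma integral_excess_le (hA2 : Integrable (fun q => A q ^ 2) m)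
    (hBi : Integrable B m) (hB0 : ∀ q, 0 ≤ B q)
    (hY : ∀ᵐ q ∂m, |Y q| ≤ A q + B q) (hS : 0 < S) (hτ : 0 < τ) (hp1 : 1 < p)
    (hA : ∫ q, A q ^ 2 ∂m ≤ 16 * S ^ 2)
    (htail : ∀ t, 0 < t → m.real {q | t < B q} ≤ (S / t) ^ p) :
    ∫ q, |Y q - clip τ (Y q)| ∂m ≤ 8 * S ^ 2 / τ + S ^ p * ((τ / 2) ^ (1 - p) / (p - 1)) := by
  have hBi' : Integrable (fun q => max (B q) (τ / 2) - τ / 2) m :=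
    (hBi.sup (integrable_const _)).sub (integrable_const _)
  calc ∫ q, |Y q - clip τ (Y q)| ∂m
      ≤ ∫ q, (A q ^ 2 / (2 * τ) + (max (B q) (τ / 2) - τ / 2)) ∂m := by
        refine integral_mono_of_nonneg (.of_forall fun q => abs_nonneg _)
          ((hA2.div_const _).add hBi') ?_
        filter_upwards [hY] with q hq
        rw [abs_sub_clip hτ.le]
        exact max_sub_le_of_le_add hτ hq
    _ = (∫ q, A q ^ 2 ∂m) / (2 * τ) + ∫ q, (max (B q) (τ / 2) - τ / 2) ∂m := by
        rw [integral_add (hA2.div_const _) hBi', integral_div]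
    _ ≤ 16 * S ^ 2 / (2 * τ) + S ^ p * ((τ / 2) ^ (1 - p) / (p - 1)) := by
        gcongr
        exact integral_max_sub_le hBi hB0 hS (by positivity) hp1 htail
    _ = _ := by ring

lemma integral_clip_sq_le (hA2 : Integrable (fun q => A q ^ 2) m)
    (hA0 : ∀ q, 0 ≤ A q) (hBm : Measurable B) (hB0 : ∀ q, 0 ≤ B q)
    (hY : ∀ᵐ q ∂m, |Y q| ≤ A q + B q) (hS : 0 < S) (hSτ : S ≤ τ) (hp2 : p ≤ 2)
    (hA : ∫ q, A q ^ 2 ∂m ≤ 16 * S ^ 2)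
    (htail : ∀ t, 0 < t → m.real {q | t < B q} ≤ (S / t) ^ p) :
    ∫ q, clip τ (Y q) ^ 2 ∂m ≤ 34 * S ^ 2 + 4 * (S ^ p * τ ^ (2 - p) * Real.log (τ / S)) := by
  have hτ : 0 < τ := hS.trans_le hSτ
  have hBi : Integrable (fun q => (min (B q) τ) ^ 2) m := by
    refine Integrable.of_bound (by fun_prop) (τ ^ 2) (.of_forall fun q => ?_)
    have h0 : 0 ≤ min (B q) τ := le_min (hB0 q) hτ.le
    rw [Real.norm_eq_abs, abs_of_nonneg (by positivity)]
    exact pow_le_pow_left₀ h0 (min_le_right _ _) 2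
  calc ∫ q, clip τ (Y q) ^ 2 ∂m ≤ ∫ q, (2 * A q ^ 2 + 2 * (min (B q) τ) ^ 2) ∂m := by
        refine integral_mono_of_nonneg (.of_forall fun q => sq_nonneg _)
          ((hA2.const_mul _).add (hBi.const_mul _)) ?_
        filter_upwards [hY] with q hq
        rw [← sq_abs, abs_clip hτ.le]
        exact min_sq_le_of_le_add hτ (abs_nonneg _) (hA0 q) hq
    _ = 2 * (∫ q, A q ^ 2 ∂m) + 2 * ∫ q, (min (B q) τ) ^ 2 ∂m := by
        rw [integral_add (hA2.const_mul _) (hBi.const_mul _), integral_const_mul,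
          integral_const_mul]
    _ ≤ _ := by
        -- `34 = 2 · 16 + 2`: the signal, plus the levels of the noise below `S²`.
        have := integral_min_sq_le hBm hB0 hS hSτ hp2 htail
        linarith

end Decomposition

/-! ### Bias and variance at the threshold `τ = 8Sk`. -/

section Arithmetic

variable {S k p : ℝ}

/-- The signal part is `S/k ≤ S k^(1-p)` since `p ≤ 2`; the noise part carries `4^(1-p)`, bounded
generously by `2^(4-p)`. -/
lemma bias_arith (hS : 0 < S) (hk : 1 ≤ k) (hp1 : 1 < p) (hp2 : p ≤ 2) :
    8 * S ^ 2 / (8 * S * k) + S ^ p * ((8 * S * k / 2) ^ (1 - p) / (p - 1)) ≤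
      (1 + (2 : ℝ) ^ (4 - p) / (p - 1)) * (S * k ^ (1 - p)) := by
  have hk0 : 0 < k := one_pos.trans_le hk
  have h1 : 8 * S ^ 2 / (8 * S * k) = S * k⁻¹ := by field_simp
  have h2 : k⁻¹ ≤ k ^ (1 - p) := by
    rw [← Real.rpow_neg_one]
    exact Real.rpow_le_rpow_of_exponent_le hk (by linarith)
  have h3 : S ^ p * (8 * S * k / 2) ^ (1 - p) = (4 : ℝ) ^ (1 - p) * (S * k ^ (1 - p)) := by
    rw [show 8 * S * k / 2 = 4 * (S * k) by ring, Real.mul_rpow (by norm_num) (by positivity),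
      Real.mul_rpow hS.le hk0.le]
    have : S ^ p * S ^ (1 - p) = S := by
      rw [← Real.rpow_add hS, add_sub_cancel, Real.rpow_one]
    linear_combination (4 ^ (1 - p) * k ^ (1 - p)) * this
  have h4 : (4 : ℝ) ^ (1 - p) ≤ (2 : ℝ) ^ (4 - p) :=
    (Real.rpow_le_one_of_one_le_of_nonpos (by norm_num) (by linarith)).trans
      (Real.one_le_rpow (by norm_num) (by linarith))
  have hp : 0 < p - 1 := by linarith
  rw [h1, mul_div_assoc', h3, mul_div_right_comm, add_mul, one_mul]
  gcongr

/-- In units of `S² k^(2-p) (1 + p log k)` the left side is at most `34 + 32 · 2.1`, using `8^(2-p)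
≤ 8` and `log 8 < 2.1`, while the right side is `2 · 8² = 128`. -/
lemma variance_arith (hS : 0 < S) (hk : 1 ≤ k) (hp1 : 1 < p) (hp2 : p ≤ 2) :
    34 * S ^ 2 + 4 * (S ^ p * (8 * S * k) ^ (2 - p) * Real.log (8 * S * k / S)) ≤
      2 * ((8 * S * k) ^ 2 * k ^ (-p) * (1 + p * Real.log k)) := by
  have hk0 : 0 < k := one_pos.trans_le hk
  have hlk : 0 ≤ Real.log k := Real.log_nonneg hk
  have h1 : S ^ p * (8 * S * k) ^ (2 - p) = S ^ 2 * ((8 : ℝ) ^ (2 - p) * k ^ (2 - p)) := by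
    rw [show 8 * S * k = 8 * k * S by ring, Real.mul_rpow (by positivity) hS.le,
      Real.mul_rpow (by norm_num) hk0.le]
    have : S ^ p * S ^ (2 - p) = S ^ 2 := by
      rw [← Real.rpow_add hS, add_sub_cancel, Real.rpow_two]
    linear_combination (8 ^ (2 - p) * k ^ (2 - p)) * this
  have h2 : Real.log (8 * S * k / S) = 3 * Real.log 2 + Real.log k := by
    rw [show 8 * S * k / S = (2 : ℝ) ^ 3 * k by field_simp; norm_num,
      Real.log_mul (by norm_num) hk0.ne', Real.log_pow]
    norm_num
  have h3 : (8 * S * k) ^ 2 * k ^ (-p) = 64 * (S ^ 2 * k ^ (2 - p)) := by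
    rw [sub_eq_add_neg, Real.rpow_add hk0, Real.rpow_two]
    ring
  have h8 : (8 : ℝ) ^ (2 - p) ≤ 8 := by
    simpa using Real.rpow_le_rpow_of_exponent_le (x := 8) (by norm_num)
      (by linarith : 2 - p ≤ 1)
  have hk2 : 1 ≤ k ^ (2 - p) := Real.one_le_rpow hk (by linarith)
  have hl2 := Real.log_two_lt_d9
  have hl20 := Real.log_two_gt_d9
  have hlk2 : Real.log k ≤ p * Real.log k := le_mul_of_one_le_left hlk hp1.le
  rw [h1, h2, h3]
  set K := k ^ (2 - p)
  set ρ := 1 + p * Real.log k with hρ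
  have hρ1 : 1 ≤ ρ := by rw [hρ]; linarith
  have hlog : 3 * Real.log 2 + Real.log k ≤ 21 / 10 * ρ := by linarith
  have hKρ : 1 ≤ K * ρ := one_le_mul_of_one_le_of_one_le hk2 hρ1
  calc 34 * S ^ 2 + 4 * (S ^ 2 * (8 ^ (2 - p) * K) * (3 * Real.log 2 + Real.log k))
      ≤ 34 * (S ^ 2 * (K * ρ)) + 4 * (S ^ 2 * (8 * K) * (21 / 10 * ρ)) := by
        gcongr
        exact le_mul_of_one_le_right (by positivity) hKρ
    _ ≤ 2 * (64 * (S ^ 2 * K) * ρ) := by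
        have : 0 ≤ S ^ 2 * (K * ρ) := by positivity
        linarith

end Arithmetic

/-! ### Concentration of empirical sums of i.i.d. vectors. -/

section SampleMean

variable {E : Type*} [NormedAddCommGroup E] [InnerProductSpace ℝ E] [FiniteDimensional ℝ E]
  [MeasurableSpace E] [BorelSpace E]
  {α : Type*} [MeasurableSpace α] {m : Measure α} [IsProbabilityMeasure m]
  {Ω : Type*} [MeasurableSpace Ω] {Pr : Measure Ω} [IsProbabilityMeasure Pr]

lemma integral_norm_sub_integral_sq_le {W : α → E} (hW : Measurable W) {C : ℝ}
    (hC : ∀ q, ‖W q‖ ≤ C) : ∫ q, ‖W q - ∫ r, W r ∂m‖ ^ 2 ∂m ≤ ∫ q, ‖W q‖ ^ 2 ∂m := by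
  have hWi : Integrable W m := Integrable.of_bound hW.aestronglyMeasurable C (.of_forall hC)
  have hW2 : Integrable (fun q => ‖W q‖ ^ 2) m := by
    refine Integrable.of_bound (by fun_prop) (C ^ 2) (.of_forall fun q => ?_)
    rw [norm_pow, norm_norm]
    exact pow_le_pow_left₀ (norm_nonneg _) (hC q) 2
  set w := ∫ r, W r ∂m with hw
  have hi : Integrable (fun q => 2 * inner ℝ w (W q)) m := (hWi.const_inner w).const_mul 2
  have hexp : ∀ q, ‖W q - w‖ ^ 2 = ‖W q‖ ^ 2 - 2 * inner ℝ w (W q) + ‖w‖ ^ 2 := fun q => by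
    rw [norm_sub_sq_real, real_inner_comm]
  simp only [hexp]
  rw [integral_add (by exact hW2.sub hi) (integrable_const _), integral_sub hW2 hi,
    integral_const_mul, integral_inner hWi, ← hw, real_inner_self_eq_norm_sq]
  simp
  nlinarith [sq_nonneg ‖w‖]

/-- Concentration of the empirical sum of a bounded vector-valued statistic of an i.i.d. sample. -/
lemma measure_norm_sum_sub_integral_gt_le {W : α → E} (hW : Measurable W) {C s v : ℝ}
    (hC : ∀ q, ‖W q‖ ≤ C) (hs : 0 ≤ s) (hsC : s * (2 * C) ≤ 1) (hv : ∫ q, ‖W q‖ ^ 2 ∂m ≤ v)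
    {ι : Type*} [Fintype ι] {Q : ι → Ω → α} (hlaw : ∀ l, HasLaw (Q l) m Pr)
    (hind : iIndepFun Q Pr) (t : ℝ) :
    Pr.real {ω | t < s * ‖∑ l, (W (Q l ω) - ∫ q, W q ∂m)‖} ≤
      2 * Real.exp (Fintype.card ι * (s ^ 2 * v) - t) := by
  set w := ∫ q, W q ∂m with hw
  have hWi : Integrable W m := Integrable.of_bound hW.aestronglyMeasurable C (.of_forall hC)
  have hwC : ‖w‖ ≤ C := by
    simpa using norm_integral_le_of_norm_le_const (μ := m) (f := W) (.of_forall hC)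
  set g : α → E := fun q => s • (W q - w) with hg
  have hgm : Measurable g := by fun_prop
  have key := measure_norm_sum_gt_le (Pr := Pr) (X := fun l ω => g (Q l ω)) (V := s ^ 2 * v)
    (fun l => hgm.comp_aemeasurable (hlaw l).aemeasurable)
    (fun l => .of_forall fun ω => ?_) (fun l => ?_)
    (hind.comp (fun _ => g) (fun _ => hgm)) (fun l => ?_) t
  · have : ∀ ω, ‖∑ l, g (Q l ω)‖ = s * ‖∑ l, (W (Q l ω) - w)‖ := fun ω => by
      rw [hg, ← Finset.smul_sum, norm_smul, Real.norm_eq_abs, abs_of_nonneg hs]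
    simpa only [this] using key
  · rw [hg, norm_smul, Real.norm_eq_abs, abs_of_nonneg hs]
    refine le_trans ?_ hsC
    gcongr
    exact (norm_sub_le _ _).trans (by linarith [hC (Q l ω)])
  · rw [← Function.comp_def g, (hlaw l).integral_comp hgm.aestronglyMeasurable, hg, integral_smul,
      integral_sub hWi (integrable_const _)]
    simp [hw]
  · have h2 := (hlaw l).integral_comp (f := fun q => ‖g q‖ ^ 2) (by fun_prop)
    rw [Function.comp_def] at h2
    rw [h2]
    have : ∀ q, ‖g q‖ ^ 2 = s ^ 2 * ‖W q - w‖ ^ 2 := fun q => by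
      rw [hg, norm_smul, mul_pow, Real.norm_eq_abs, sq_abs]
    simp only [this]
    rw [integral_const_mul]
    gcongr
    exact (integral_norm_sub_integral_sq_le hW hC).trans hv

end SampleMean

/-! ### The two-point estimator: approximation, mean, bias and scale. -/

section TwoPoint

variable {d : ℕ} {Ξ : Type*} {F : EuclideanSpace ℝ (Fin d) → Ξ → ℝ} {L μ : ℝ}

/-- Two Taylor errors of `Lμ²/2`, one for each sign of the step, are divided by `2μ`. -/
lemma abs_twoPoint_sub_inner_le {ξ : Ξ} (hd : Differentiable ℝ fun y => F y ξ)
    (hL : ∀ y z, ‖gradient (fun w => F w ξ) y - gradient (fun w => F w ξ) z‖ ≤ L * ‖y - z‖)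
    (hμ : 0 < μ) (x : EuclideanSpace ℝ (Fin d))
    (u : Metric.sphere (0 : EuclideanSpace ℝ (Fin d)) 1) :
    |twoPoint μ F x u ξ - inner ℝ (gradient (fun w => F w ξ) x) (u : EuclideanSpace ℝ (Fin d))| ≤
      L * μ / 2 := by
  set G := gradient (fun w => F w ξ) x
  have h1 := abs_le.1 (abs_sub_sub_inner_gradient_le hd hL x (μ • (u : EuclideanSpace ℝ (Fin d))))
  have h2 := abs_le.1
    (abs_sub_sub_inner_gradient_le hd hL x (-(μ • (u : EuclideanSpace ℝ (Fin d)))))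
  simp only [inner_neg_right, inner_smul_right, norm_neg, norm_smul, norm_eq_of_mem_sphere,
    mul_one, Real.norm_eq_abs, sq_abs, ← sub_eq_add_neg] at h1 h2
  have h3 : twoPoint μ F x u ξ - inner ℝ G (u : EuclideanSpace ℝ (Fin d)) =
      (F (x + μ • (u : EuclideanSpace ℝ (Fin d))) ξ - F (x - μ • (u : EuclideanSpace ℝ (Fin d))) ξ
        - 2 * (μ * inner ℝ G (u : EuclideanSpace ℝ (Fin d)))) / (2 * μ) := by
    rw [twoPoint]
    field_simp
  rw [h3, abs_div, abs_of_pos (by positivity : 0 < 2 * μ), div_le_iff₀ (by positivity), abs_le]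
  constructor <;> linarith [h1.1, h1.2, h2.1, h2.2]

lemma abs_twoPoint_le {ξ : Ξ} (hd : Differentiable ℝ fun y => F y ξ)
    (hL : ∀ y z, ‖gradient (fun w => F w ξ) y - gradient (fun w => F w ξ) z‖ ≤ L * ‖y - z‖)
    (hμ : 0 < μ) (x g : EuclideanSpace ℝ (Fin d))
    (u : Metric.sphere (0 : EuclideanSpace ℝ (Fin d)) 1) :
    |twoPoint μ F x u ξ| ≤ (|inner ℝ g (u : EuclideanSpace ℝ (Fin d))| + L * μ / 2) +
      |inner ℝ (gradient (fun w => F w ξ) x - g) (u : EuclideanSpace ℝ (Fin d))| := by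
  have h1 := abs_twoPoint_sub_inner_le hd hL hμ x u
  set a := inner ℝ g (u : EuclideanSpace ℝ (Fin d)) with ha
  set b := inner ℝ (gradient (fun w => F w ξ) x - g) (u : EuclideanSpace ℝ (Fin d)) with hb
  have h2 : inner ℝ (gradient (fun w => F w ξ) x) (u : EuclideanSpace ℝ (Fin d)) = a + b := by
    rw [ha, hb, inner_sub_left]; ring
  rw [h2] at h1
  calc |twoPoint μ F x u ξ| = |(twoPoint μ F x u ξ - (a + b)) + (a + b)| := by ring_nf
    _ ≤ |twoPoint μ F x u ξ - (a + b)| + |a + b| := abs_add_le _ _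
    _ ≤ L * μ / 2 + (|a| + |b|) := add_le_add h1 (abs_add_le _ _)
    _ = _ := by ring

variable [MeasurableSpace Ξ] {P : Measure Ξ}

lemma measurable_twoPoint (hFdiff : ∀ ξ, Differentiable ℝ (fun y => F y ξ))
    (hFmeas : ∀ y, Measurable (F y)) (μ : ℝ) (x : EuclideanSpace ℝ (Fin d)) :
    Measurable fun q : Metric.sphere (0 : EuclideanSpace ℝ (Fin d)) 1 × Ξ =>
      twoPoint μ F x q.1 q.2 := by
  -- Carathéodory: continuity in the point and measurability in the sample give joint measurability.
  have hF : Measurable (Function.uncurry F) :=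
    measurable_uncurry_of_continuous_of_measurable (fun ξ => (hFdiff ξ).continuous) hFmeas
  have h1 : Measurable fun q : Metric.sphere (0 : EuclideanSpace ℝ (Fin d)) 1 × Ξ =>
      F (x + μ • (q.1 : EuclideanSpace ℝ (Fin d))) q.2 :=
    hF.comp (by fun_prop : Measurable fun q : Metric.sphere (0 : EuclideanSpace ℝ (Fin d)) 1 × Ξ =>
      (x + μ • (q.1 : EuclideanSpace ℝ (Fin d)), q.2))
  have h2 : Measurable fun q : Metric.sphere (0 : EuclideanSpace ℝ (Fin d)) 1 × Ξ =>
      F (x - μ • (q.1 : EuclideanSpace ℝ (Fin d))) q.2 :=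
    hF.comp (by fun_prop : Measurable fun q : Metric.sphere (0 : EuclideanSpace ℝ (Fin d)) 1 × Ξ =>
      (x - μ • (q.1 : EuclideanSpace ℝ (Fin d)), q.2))
  exact (h1.sub h2).div_const _

lemma ae_abs_twoPoint_le (hd : 1 ≤ d) (hFdiff : ∀ ξ, Differentiable ℝ (fun y => F y ξ))
    (hsmooth : ∀ᵐ ξ ∂P, ∀ y z,
      ‖gradient (fun w => F w ξ) y - gradient (fun w => F w ξ) z‖ ≤ L * ‖y - z‖)
    (hμ : 0 < μ) (x g : EuclideanSpace ℝ (Fin d)) :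
    ∀ᵐ q ∂((unifSphere d).prod P), |twoPoint μ F x q.1 q.2| ≤
      (|inner ℝ g (q.1 : EuclideanSpace ℝ (Fin d))| + L * μ / 2) +
        |inner ℝ (gradient (fun w => F w q.2) x - g) (q.1 : EuclideanSpace ℝ (Fin d))| := by
  have := isProbabilityMeasure_unifSphere hd
  filter_upwards [Measure.quasiMeasurePreserving_snd.ae hsmooth] with q hq
  exact abs_twoPoint_le (hFdiff q.2) hq hμ x g q.1

variable [IsProbabilityMeasure P]

lemma integrable_abs_inner_noise (hd : 1 ≤ d) {N : Ξ → EuclideanSpace ℝ (Fin d)}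
    (hNm : Measurable N) (hN : Integrable N P) :
    Integrable (fun q : Metric.sphere (0 : EuclideanSpace ℝ (Fin d)) 1 × Ξ =>
      |inner ℝ (N q.2) (q.1 : EuclideanSpace ℝ (Fin d))|) ((unifSphere d).prod P) := by
  have := isProbabilityMeasure_unifSphere hd
  refine Integrable.mono' (g := fun q => ‖N q.2‖) (hN.norm.comp_snd _)
    (Measurable.aestronglyMeasurable (by fun_prop)) (.of_forall fun q => ?_)
  rw [Real.norm_eq_abs, abs_abs]
  exact norm_inner_sphere_le _ _

lemma integrable_twoPoint (hd : 1 ≤ d) (hFdiff : ∀ ξ, Differentiable ℝ (fun y => F y ξ))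
    (hFmeas : ∀ y, Measurable (F y)) (hFint : ∀ y, Integrable (F y) P)
    (hsmooth : ∀ᵐ ξ ∂P, ∀ y z,
      ‖gradient (fun w => F w ξ) y - gradient (fun w => F w ξ) z‖ ≤ L * ‖y - z‖)
    (hμ : 0 < μ) (x : EuclideanSpace ℝ (Fin d)) :
    Integrable (fun q : Metric.sphere (0 : EuclideanSpace ℝ (Fin d)) 1 × Ξ =>
      twoPoint μ F x q.1 q.2) ((unifSphere d).prod P) := by
  have := isProbabilityMeasure_unifSphere hd
  have hN := integrable_abs_inner_noise hd (measurable_gradient hFdiff hFmeas x)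
    (integrable_gradient hFdiff hFmeas hFint hsmooth x)
  refine Integrable.mono' ((integrable_const (L * μ / 2)).add hN)
    (measurable_twoPoint hFdiff hFmeas μ x).aestronglyMeasurable ?_
  filter_upwards [ae_abs_twoPoint_le hd hFdiff hsmooth hμ x 0] with q hq
  simpa using hq

lemma integrable_smul_sphere {m : Measure (Metric.sphere (0 : EuclideanSpace ℝ (Fin d)) 1 × Ξ)}
    {Y : Metric.sphere (0 : EuclideanSpace ℝ (Fin d)) 1 × Ξ → ℝ} (hY : Integrable Y m) :
    Integrable (fun q => Y q • (q.1 : EuclideanSpace ℝ (Fin d))) m := by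
  refine hY.mono (hY.aestronglyMeasurable.smul
    (Measurable.aestronglyMeasurable (by fun_prop))) (.of_forall fun q => ?_)
  simp [norm_smul]

/-- The gradient of the smoothed objective is the mean of the two-point estimator. -/
lemma gradient_smoothing_eq (hd : 1 ≤ d) (hFdiff : ∀ ξ, Differentiable ℝ (fun y => F y ξ))
    (hFmeas : ∀ y, Measurable (F y)) (hFint : ∀ y, Integrable (F y) P)
    (hsmooth : ∀ᵐ ξ ∂P, ∀ y z,
      ‖gradient (fun w => F w ξ) y - gradient (fun w => F w ξ) z‖ ≤ L * ‖y - z‖)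
    (hμ : 0 < μ) (x : EuclideanSpace ℝ (Fin d)) :
    gradient (smoothing μ (objective P F)) x =
      (d : ℝ) • ∫ q, twoPoint μ F x q.1 q.2 • (q.1 : EuclideanSpace ℝ (Fin d))
        ∂((unifSphere d).prod P) := by
  have := isProbabilityMeasure_unifSphere hd
  have hYi := integrable_twoPoint hd hFdiff hFmeas hFint hsmooth hμ x
  have hYu := integrable_smul_sphere hYi
  refine ext_inner_right ℝ fun e => ?_
  rw [inner_gradient_smoothing hd
    (fun y => (hasGradientAt_objective hFdiff hFmeas hFint hsmooth y).differentiableAt)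
    (norm_gradient_objective_sub_le hFdiff hFmeas hFint hsmooth) hμ x e, inner_smul_left,
    conj_trivial, real_inner_comm, ← integral_inner hYu, integral_prod _ (hYu.const_inner e)]
  congr 1
  refine integral_congr_ae (.of_forall fun u => ?_)
  simp only [inner_smul_right, integral_mul_const, twoPoint, integral_div]
  rw [integral_sub (hFint _) (hFint _), real_inner_comm]
  rfl

/-- The clipping bias of the two-point estimator. -/
lemma norm_integral_clip_sub_gradient_le (hd : 1 ≤ d)
    (hFdiff : ∀ ξ, Differentiable ℝ (fun y => F y ξ))
    (hFmeas : ∀ y, Measurable (F y)) (hFint : ∀ y, Integrable (F y) P)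
    (hsmooth : ∀ᵐ ξ ∂P, ∀ y z,
      ‖gradient (fun w => F w ξ) y - gradient (fun w => F w ξ) z‖ ≤ L * ‖y - z‖)
    (hμ : 0 < μ) (x : EuclideanSpace ℝ (Fin d)) {τ : ℝ} (hτ : 0 ≤ τ) :
    ‖(d : ℝ) • (∫ q, clip τ (twoPoint μ F x q.1 q.2) • (q.1 : EuclideanSpace ℝ (Fin d))
        ∂((unifSphere d).prod P)) - gradient (smoothing μ (objective P F)) x‖ ≤
      d * ∫ q : Metric.sphere (0 : EuclideanSpace ℝ (Fin d)) 1 × Ξ,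
        |twoPoint μ F x q.1 q.2 - clip τ (twoPoint μ F x q.1 q.2)| ∂((unifSphere d).prod P) := by
  have := isProbabilityMeasure_unifSphere hd
  have hYi := integrable_twoPoint hd hFdiff hFmeas hFint hsmooth hμ x
  have hYm := measurable_twoPoint hFdiff hFmeas μ x
  have hCi : Integrable (fun q : Metric.sphere (0 : EuclideanSpace ℝ (Fin d)) 1 × Ξ =>
      clip τ (twoPoint μ F x q.1 q.2)) ((unifSphere d).prod P) := by
    refine Integrable.of_bound ((measurable_clip τ).comp hYm).aestronglyMeasurable τ
      (.of_forall fun q => ?_)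
    rw [Real.norm_eq_abs, abs_clip hτ]
    exact min_le_right _ _
  rw [gradient_smoothing_eq hd hFdiff hFmeas hFint hsmooth hμ x, ← smul_sub,
    ← integral_sub (integrable_smul_sphere hCi) (integrable_smul_sphere hYi), norm_smul]
  simp only [Real.norm_natCast]
  gcongr
  refine (norm_integral_le_integral_norm _).trans_eq (integral_congr_ae (.of_forall fun q => ?_))
  simp only
  rw [← sub_smul, norm_smul, norm_eq_of_mem_sphere, mul_one, Real.norm_eq_abs, abs_sub_comm]

lemma integral_sq_abs_inner_add_le (hd : 1 ≤ d) (g : EuclideanSpace ℝ (Fin d)) (c : ℝ) :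
    Integrable (fun q : Metric.sphere (0 : EuclideanSpace ℝ (Fin d)) 1 × Ξ =>
      (|inner ℝ g (q.1 : EuclideanSpace ℝ (Fin d))| + c) ^ 2) ((unifSphere d).prod P) ∧
    ∫ q : Metric.sphere (0 : EuclideanSpace ℝ (Fin d)) 1 × Ξ,
      (|inner ℝ g (q.1 : EuclideanSpace ℝ (Fin d))| + c) ^ 2 ∂((unifSphere d).prod P) ≤
        2 * (‖g‖ ^ 2 / d) + 2 * c ^ 2 := by
  have := isProbabilityMeasure_unifSphere hd
  have hi := integrable_inner_sq_unifSphere hd g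
  have hR : Integrable (fun u : Metric.sphere (0 : EuclideanSpace ℝ (Fin d)) 1 =>
      2 * (inner ℝ g (u : EuclideanSpace ℝ (Fin d))) ^ 2 + 2 * c ^ 2) (unifSphere d) :=
    (hi.const_mul 2).add (integrable_const _)
  have hle : ∀ u : Metric.sphere (0 : EuclideanSpace ℝ (Fin d)) 1,
      (|inner ℝ g (u : EuclideanSpace ℝ (Fin d))| + c) ^ 2 ≤
        2 * (inner ℝ g (u : EuclideanSpace ℝ (Fin d))) ^ 2 + 2 * c ^ 2 := fun u => by
    rw [← sq_abs (inner ℝ g (u : EuclideanSpace ℝ (Fin d)))]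
    nlinarith [sq_nonneg (|inner ℝ g (u : EuclideanSpace ℝ (Fin d))| - c)]
  have hL : Integrable (fun u : Metric.sphere (0 : EuclideanSpace ℝ (Fin d)) 1 =>
      (|inner ℝ g (u : EuclideanSpace ℝ (Fin d))| + c) ^ 2) (unifSphere d) := by
    refine hR.mono' (by fun_prop) (.of_forall fun u => ?_)
    rw [Real.norm_eq_abs, abs_of_nonneg (sq_nonneg _)]
    exact hle u
  refine ⟨hL.comp_fst P, ?_⟩
  have h1 := integral_fun_fst (μ := unifSphere d) (ν := P)
    (fun u : Metric.sphere (0 : EuclideanSpace ℝ (Fin d)) 1 =>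
      (|inner ℝ g (u : EuclideanSpace ℝ (Fin d))| + c) ^ 2)
  rw [h1]
  simp only [probReal_univ, one_smul]
  refine (integral_mono hL hR hle).trans_eq ?_
  rw [integral_add (hi.const_mul 2) (integrable_const _), integral_const_mul,
    integral_inner_sq_unifSphere hd]
  simp

lemma barGap_nonneg {f : EuclideanSpace ℝ (Fin d) → ℝ} (hb : BddBelow (Set.range f)) (hL : 0 ≤ L)
    (x₀ : EuclideanSpace ℝ (Fin d)) : 0 ≤ barGap L μ f x₀ := by
  have := ciInf_le hb x₀
  have : 0 ≤ L * μ ^ 2 / 2 := by positivity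
  rw [barGap]
  linarith

lemma div_sqrt_le_scale {f : EuclideanSpace ℝ (Fin d) → ℝ} {σ : ℝ} (hL : 0 ≤ L) (hμ : 0 < μ)
    (x₀ : EuclideanSpace ℝ (Fin d)) : σ / √(d : ℝ) ≤ scale L μ σ f x₀ := by
  rw [scale, add_div]
  have : 0 ≤ √(L * barGap L μ f x₀) / √(d : ℝ) := by positivity
  have : 0 ≤ L * μ := by positivity
  linarith

/-- With `G = ‖∇f(x)‖²` this bounds the second moment of the signal. The 8 is `2L` times the
localisation factor 4, and doubling it gives 16. -/
lemma signal_le_scale_sq (hd : 1 ≤ d) {f : EuclideanSpace ℝ (Fin d) → ℝ}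
    (hb : BddBelow (Set.range f)) {σ G : ℝ}
    (hL : 0 ≤ L) (hμ : 0 < μ) (hσ : 0 < σ) (x₀ : EuclideanSpace ℝ (Fin d))
    (hG : G ≤ 8 * (L * barGap L μ f x₀)) :
    2 * (G / d) + 2 * (L * μ / 2) ^ 2 ≤ 16 * scale L μ σ f x₀ ^ 2 := by
  have hd0 : (0 : ℝ) < d := by positivity
  have hΔ : 0 ≤ L * barGap L μ f x₀ := mul_nonneg hL (barGap_nonneg hb hL x₀)
  have hq : (√(L * barGap L μ f x₀) / √(d : ℝ)) ^ 2 = L * barGap L μ f x₀ / d := by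
    rw [div_pow, Real.sq_sqrt hΔ, Real.sq_sqrt hd0.le]
  set a := √(L * barGap L μ f x₀) / √(d : ℝ) with ha
  have ha0 : 0 ≤ a := by positivity
  have hb0 : 0 ≤ L * μ := by positivity
  have hS : a + L * μ ≤ scale L μ σ f x₀ := by
    rw [scale, add_div]
    have : 0 ≤ σ / √(d : ℝ) := by positivity
    linarith
  have h1 : G / d ≤ 8 * a ^ 2 := by
    rw [hq, mul_div_assoc']
    gcongr
  nlinarith [pow_le_pow_left₀ (by positivity) hS 2, mul_nonneg ha0 hb0]

end TwoPoint

end ZerothOrder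

/-! ### Assembly of bias and fluctuation. -/

theorem theorem1 {d : ℕ} (hd : 1 ≤ d)
    -- the stochastic objective
    {Ξ : Type*} [MeasurableSpace Ξ] (P : Measure Ξ) [IsProbabilityMeasure P]
    (F : EuclideanSpace ℝ (Fin d) → Ξ → ℝ)
    (hFdiff : ∀ ξ, Differentiable ℝ (fun y => F y ξ))
    (hFmeas : ∀ y, Measurable (F y))
    (hFint : ∀ y, Integrable (F y) P)
    (hbdd : BddBelow (Set.range (ZerothOrder.objective P F)))
    -- sample smoothness
    (L : ℝ) (hL : 0 ≤ L)
    (hsmooth : ∀ᵐ ξ ∂P, ∀ y z,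
      ‖gradient (fun w => F w ξ) y - gradient (fun w => F w ξ) z‖ ≤ L * ‖y - z‖)
    -- weak `L_p` control of the gradient noise
    (p σ : ℝ) (hp1 : 1 < p) (hp2 : p ≤ 2) (hσ : 0 < σ)
    (hnoise : ∀ y, ∀ t : ℝ, 0 < t →
      P.real {ξ | t < ‖gradient (fun w => F w ξ) y - gradient (ZerothOrder.objective P F) y‖}
        ≤ (σ / t) ^ p)
    -- parameters
    (μ : ℝ) (hμ : 0 < μ) (δ T lam : ℝ) (hδ0 : 0 < δ) (hδ1 : δ ≤ 1) (hT : 3 ≤ T)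
    (hlam : lam = Real.log (T / δ)) (M : ℕ) (hM : lam ≤ M)
    -- the starting point and the localized point
    (x₀ x : EuclideanSpace ℝ (Fin d))
    (hx : ZerothOrder.objective P F x - (⨅ y, ZerothOrder.objective P F y)
      ≤ 4 * ZerothOrder.barGap L μ (ZerothOrder.objective P F) x₀)
    (S τ : ℝ) (hS : S = ZerothOrder.scale L μ σ (ZerothOrder.objective P F) x₀)
    (hτ : τ = 8 * S * ((M : ℝ) / lam) ^ (1 / p))
    -- the i.i.d. samples
    {Ω : Type*} [MeasurableSpace Ω] (Pr : Measure Ω) [IsProbabilityMeasure Pr]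
    (u : Fin M → Ω → Metric.sphere (0 : EuclideanSpace ℝ (Fin d)) 1) (ξ : Fin M → Ω → Ξ)
    (hlaw : ∀ l, HasLaw (fun ω => (u l ω, ξ l ω)) ((ZerothOrder.unifSphere d).prod P) Pr)
    (hindep : iIndepFun (fun l ω => (u l ω, ξ l ω)) Pr) :
    DifferentiableAt ℝ (ZerothOrder.smoothing μ (ZerothOrder.objective P F)) x ∧
    1 - δ / T ≤ Pr.real {ω |
      ‖ZerothOrder.estimator μ τ F (fun l => u l ω) (fun l => ξ l ω) x
          - gradient (ZerothOrder.smoothing μ (ZerothOrder.objective P F)) x‖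
        ≤ (120 + (2 : ℝ) ^ (4 - p) / (p - 1)) * d * S * (lam / M) ^ ((p - 1) / p)
          * √(1 + Real.log (M / lam))} := by
  have hd0 : (0 : ℝ) < d := by positivity
  have hQ := ZerothOrder.isProbabilityMeasure_unifSphere hd
  set f := ZerothOrder.objective P F with hf
  have hfd : Differentiable ℝ f := fun y =>
    (ZerothOrder.hasGradientAt_objective hFdiff hFmeas hFint hsmooth y).differentiableAt
  have hfL := ZerothOrder.norm_gradient_objective_sub_le hFdiff hFmeas hFint hsmooth
  refine ⟨(ZerothOrder.hasGradientAt_smoothing hfd hfL μ x).differentiableAt, ?_⟩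
  -- parameters
  have hTδ : 3 ≤ T / δ := by
    rw [le_div_iff₀ hδ0]
    linarith
  -- `T/δ ≥ 3 > e`; this lets the factor 2 of the tail bound be absorbed below.
  have hlam1 : 1 < lam := by
    rw [hlam, Real.lt_log_iff_exp_lt (by linarith)]
    linarith [Real.exp_one_lt_d9]
  have hexp : Real.exp (-lam) = δ / T := by
    rw [hlam, Real.exp_neg, Real.exp_log (by linarith), inv_div]
  have hlam0 : 0 < lam := by linarith
  have hM0 : (0 : ℝ) < M := hlam0.trans_le hM
  set k : ℝ := ((M : ℝ) / lam) ^ (1 / p) with hk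
  have hR1 : 1 ≤ (M : ℝ) / lam := (one_le_div hlam0).2 hM
  have hk1 : 1 ≤ k := Real.one_le_rpow hR1 (by positivity)
  have hk0 : 0 < k := one_pos.trans_le hk1
  have hp0 : 0 < p := by linarith
  have hkp : k ^ p = (M : ℝ) / lam := by
    rw [hk, ← Real.rpow_mul (by positivity), one_div_mul_cancel hp0.ne', Real.rpow_one]
  have hkr : k ^ (-p) = lam / M := by
    rw [Real.rpow_neg hk0.le, hkp, inv_div]
  have hkr' : (lam / M) ^ ((p - 1) / p) = k ^ (1 - p) := by
    rw [← hkr, ← Real.rpow_mul hk0.le]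
    congr 1
    field_simp
    ring
  have hlog : Real.log (M / lam) = p * Real.log k := by rw [← hkp, Real.log_rpow hk0]
  rw [hkr', hlog]
  set ρ := 1 + p * Real.log k with hρ
  have hρ1 : 1 ≤ ρ := by
    have := Real.log_nonneg hk1
    rw [hρ]
    nlinarith
  have hsρ1 : 1 ≤ √ρ := Real.one_le_sqrt.2 hρ1
  have hσS : σ / √(d : ℝ) ≤ S := hS ▸ ZerothOrder.div_sqrt_le_scale hL hμ x₀
  have hS0 : 0 < S := lt_of_lt_of_le (by positivity) hσS
  have hτ0 : 0 < τ := by rw [hτ]; positivity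
  have hSτ : S ≤ τ := by rw [hτ]; nlinarith
  -- signal and noise
  set Q := (ZerothOrder.unifSphere d).prod P with hQdef
  set Y : Metric.sphere (0 : EuclideanSpace ℝ (Fin d)) 1 × Ξ → ℝ :=
    fun q => ZerothOrder.twoPoint μ F x q.1 q.2 with hY
  have hYm : Measurable Y := ZerothOrder.measurable_twoPoint hFdiff hFmeas μ x
  set N : Ξ → EuclideanSpace ℝ (Fin d) :=
    fun ξ => gradient (fun w => F w ξ) x - gradient f x with hN
  have hNm : Measurable N := (ZerothOrder.measurable_gradient hFdiff hFmeas x).sub_const _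
  have hNi : Integrable N P :=
    (ZerothOrder.integrable_gradient hFdiff hFmeas hFint hsmooth x).sub (integrable_const _)
  have hBi := ZerothOrder.integrable_abs_inner_noise hd hNm hNi
  have hBm : Measurable fun q : Metric.sphere (0 : EuclideanSpace ℝ (Fin d)) 1 × Ξ =>
      |inner ℝ (N q.2) (q.1 : EuclideanSpace ℝ (Fin d))| := by fun_prop
  have hYAB := ZerothOrder.ae_abs_twoPoint_le hd hFdiff hsmooth hμ x (gradient f x)
  have htail : ∀ t, 0 < t → Q.real
      {q | t < |inner ℝ (N q.2) (q.1 : EuclideanSpace ℝ (Fin d))|} ≤ (S / t) ^ p := fun t ht =>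
    (ZerothOrder.prod_real_abs_inner_gt_le hd hNm hp0 hp2 hσ (hnoise x) ht).trans
      (Real.rpow_le_rpow (by positivity) (by gcongr) hp0.le)
  obtain ⟨hA2, hA⟩ := ZerothOrder.integral_sq_abs_inner_add_le (P := P) hd (gradient f x)
    (L * μ / 2)
  have hA' := hA.trans (ZerothOrder.signal_le_scale_sq hd hbdd hL hμ hσ x₀ (by
    have := ZerothOrder.norm_gradient_sq_le hfd hL hfL hbdd x
    nlinarith [mul_le_mul_of_nonneg_left hx hL]))
  rw [← hS] at hA'
  have hbias := ZerothOrder.integral_excess_le hA2 hBi (fun q => abs_nonneg _) hYAB hS0 hτ0 hp1 hA'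
    htail
  have hvar := ZerothOrder.integral_clip_sq_le hA2 (fun q => by positivity)
    hBm (fun q => abs_nonneg _) hYAB hS0 hSτ hp2 hA' htail
  have hbias' := hbias.trans (hτ ▸ ZerothOrder.bias_arith hS0 hk1 hp1 hp2)
  have hvar' := hvar.trans (hτ ▸ ZerothOrder.variance_arith hS0 hk1 hp1 hp2)
  rw [← hρ, hkr] at hvar'
  -- concentration
  set W : Metric.sphere (0 : EuclideanSpace ℝ (Fin d)) 1 × Ξ → EuclideanSpace ℝ (Fin d) :=
    fun q => ZerothOrder.clip τ (Y q) • (q.1 : EuclideanSpace ℝ (Fin d)) with hW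
  have hWm : Measurable W := ((ZerothOrder.measurable_clip τ).comp hYm).smul (by fun_prop)
  have hWn : ∀ q, ‖W q‖ = |ZerothOrder.clip τ (Y q)| := fun q => by
    rw [hW, norm_smul, norm_eq_of_mem_sphere, mul_one, Real.norm_eq_abs]
  have hWτ : ∀ q, ‖W q‖ ≤ τ := fun q => by
    rw [hWn, ZerothOrder.abs_clip hτ0.le]
    exact min_le_right _ _
  have hWv : ∫ q, ‖W q‖ ^ 2 ∂Q ≤ 2 * (τ ^ 2 * (lam / M) * ρ) := by
    simpa only [hWn, sq_abs] using hvar'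
  -- Since `√ρ ≥ 1`, the scaled centred terms have norm at most 1, while their total variance proxy
  -- is exactly `λ/2`. At threshold `3λ` the tail is `2 exp(-5λ/2) ≤ exp(-λ) = δ/T`.
  set s : ℝ := 1 / (2 * τ * √ρ) with hs
  have hs0 : 0 < s := by positivity
  have hconc := ZerothOrder.measure_norm_sum_sub_integral_gt_le hWm hWτ hs0.le
    (by
      rw [hs, div_mul_eq_mul_div, one_mul, div_le_one (by positivity)]
      exact le_mul_of_one_le_right (by positivity) hsρ1) hWv hlaw hindep (3 * lam)
  have hprob : 2 * Real.exp (Fintype.card (Fin M) * (s ^ 2 * (2 * (τ ^ 2 * (lam / M) * ρ))) -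
      3 * lam) ≤ δ / T := by
    have h1 : (Fintype.card (Fin M) : ℝ) * (s ^ 2 * (2 * (τ ^ 2 * (lam / M) * ρ))) = lam / 2 := by
      rw [hs, Fintype.card_fin, div_pow, mul_pow, mul_pow, Real.sq_sqrt (by linarith)]
      field_simp
    rw [h1, ← hexp]
    calc 2 * Real.exp (lam / 2 - 3 * lam) ≤ Real.exp 1 * Real.exp (lam / 2 - 3 * lam) := by
          gcongr
          linarith [Real.exp_one_gt_d9]
      _ ≤ Real.exp (-lam) := by
          rw [← Real.exp_add]
          exact Real.exp_le_exp.2 (by linarith)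
  set bad : Set Ω := {ω | 3 * lam < s * ‖∑ l, (W (u l ω, ξ l ω) - ∫ q, W q ∂Q)‖} with hbad
  set good : Set Ω := {ω |
      ‖ZerothOrder.estimator μ τ F (fun l => u l ω) (fun l => ξ l ω) x
          - gradient (ZerothOrder.smoothing μ f) x‖
        ≤ (120 + (2 : ℝ) ^ (4 - p) / (p - 1)) * d * S * k ^ (1 - p) * √ρ} with hgood
  -- A covering and subadditivity suffice, so neither event has to be shown measurable.
  have hcover : Set.univ ⊆ good ∪ bad := by
    intro ω _
    by_cases hω : ω ∈ bad
    · exact Or.inr hω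
    left
    rw [hbad, Set.mem_ofPred_eq, not_lt] at hω
    have hp1' : 0 < p - 1 := by linarith
    have hfl : (d : ℝ) / M * ‖∑ l, (W (u l ω, ξ l ω) - ∫ q, W q ∂Q)‖ ≤
        48 * (d * (S * k ^ (1 - p)) * √ρ) := by
      have h1 : ‖∑ l, (W (u l ω, ξ l ω) - ∫ q, W q ∂Q)‖ ≤ 3 * lam * (2 * τ * √ρ) := by
        rw [hs, div_mul_eq_mul_div, one_mul, div_le_iff₀ (by positivity)] at hω
        exact hω
      calc _ ≤ (d : ℝ) / M * (3 * lam * (2 * τ * √ρ)) := by gcongr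
        _ = 6 * d * τ * (lam / M) * √ρ := by ring
        _ = _ := by
          rw [← hkr, hτ, sub_eq_add_neg, Real.rpow_add hk0, Real.rpow_one]
          ring
    have hest : ZerothOrder.estimator μ τ F (fun l => u l ω) (fun l => ξ l ω) x =
        ((d : ℝ) / M) • ∑ l, (W (u l ω, ξ l ω) - ∫ q, W q ∂Q) + (d : ℝ) • ∫ q, W q ∂Q := by
      rw [Finset.sum_sub_distrib, Finset.sum_const, Finset.card_univ, Fintype.card_fin, smul_sub,
        ← Nat.cast_smul_eq_nsmul ℝ, smul_smul, div_mul_cancel₀ _ hM0.ne', sub_add_cancel]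
      rfl
    have hb := ZerothOrder.norm_integral_clip_sub_gradient_le hd hFdiff hFmeas hFint hsmooth hμ x
      hτ0.le
    have hb' : ‖(d : ℝ) • (∫ q, W q ∂Q) - gradient (ZerothOrder.smoothing μ f) x‖ ≤
        (1 + (2 : ℝ) ^ (4 - p) / (p - 1)) * (d * (S * k ^ (1 - p)) * √ρ) := by
      refine hb.trans ?_
      calc _ ≤ d * ((1 + (2 : ℝ) ^ (4 - p) / (p - 1)) * (S * k ^ (1 - p))) := by gcongr
        _ = (1 + (2 : ℝ) ^ (4 - p) / (p - 1)) * (d * (S * k ^ (1 - p))) := by ring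
        _ ≤ _ := by
          exact mul_le_mul_of_nonneg_left (le_mul_of_one_le_right (by positivity) hsρ1)
            (by positivity)
    rw [hgood, Set.mem_ofPred_eq, hest, add_sub_assoc]
    refine (norm_add_le _ _).trans ?_
    rw [norm_smul, Real.norm_eq_abs, abs_of_nonneg (by positivity)]
    have hnn : 0 ≤ d * (S * k ^ (1 - p)) * √ρ := by positivity
    -- The fluctuation contributes 48 and the bias `1 + 2^(4-p)/(p-1)`, well within the constant
    -- 120.
    linarith
  have h1 : (1 : ℝ) ≤ Pr.real good + Pr.real bad := by
    rw [← probReal_univ (μ := Pr)]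
    exact (measureReal_mono hcover).trans (measureReal_union_le _ _)
  linarith [hconc.trans hprob]
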